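/- Let $U\subseteq\mathbb{R}^4$ be a connected open set with coordinates $(u,v,x,y)$, and consider on $U$ a smooth metric-affine geometry, given by an anholonomic metric $g_{ab}$, a coframe $\vartheta^a=e_\mu{}^a\,dx^\mu$ (with dual frame $e_a$) and a connection 1-form $\Gamma_a{}^b$. Suppose that 1. the metric $g=g_{ab}\,\vartheta^a\otimes\vartheta^b$ is the pp-wave $ds^2=H(u,x,y)\,du^2+2\,du\,dv-dx^2-dy^2$ with $H$ smooth; 2. the connection is metric-compatible: $dg_{ab}-\Gamma_a{}^c g_{cb}-\Gamma_b{}^c g_{ac}=0$; 3. the torsion $T^a=d\vartheta^a+\Gamma_c{}^a\wedge\vartheta^c$ is purely axial, $T^a=\tfrac13\, g^{ab}\,e_b\lrcorner\star\overline{T}$, where $\overline{T}=\mathcal{A}(\varphi)\,du$ with phase $\varphi=u+\text{const}$ and $\mathcal{A}$ an arbitrary smooth function. Let $R_a{}^b=d\Gamma_a{}^b+\Gamma_c{}^b\wedge\Gamma_a{}^c=\tfrac12R_{cda}{}^b\,\vartheta^c\wedge\vartheta^d$ be the curvature, $\mathrm{Ric}=R_{acb}{}^c\,\vartheta^a\otimes\vartheta^b$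 the Ricci tensor of this connection $\nabla$, and $\mathring\nabla$ the Levi-Civita connection. Then $\nabla\mathrm{Ric}=\mathring\nabla\mathrm{Ric}$, and $\nabla\mathrm{Ric}=0$ on $U$ if and only if there is a constant $C\in\mathbb{R}$ with $$(\partial_x^2+\partial_y^2)H=\tfrac19\,\mathcal{A}(\varphi)^2+C\quad\text{on }U.$$ If $\nabla\mathrm{Ric}=0$ on $U$, then for every $\rho\neq0$ the vacuum equations of motion of the Lagrangian $L=-\frac{1}{2\rho}R_a{}^b\wedge\star R_b{}^a$ hold on $U$, i.e. the action $\int L$ is stationary under all smooth compactly supported variations of the coframe, the connection and the metric $g_{ab}$, taken as independent fields. -/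

import Mathlib

open scoped ContDiff
open MeasureTheory

namespace MAG

noncomputable section

/-- Points of a coordinate chart, with coordinates `(u, v, x, y)` numbered `0, 1, 2, 3`. -/
abbrev Pt : Type := Fin 4 → ℝ

/-- The partial derivative `∂_μ f` at the point `p`. -/
def pd (μ : Fin 4) (f : Pt → ℝ) (p : Pt) : ℝ :=
  fderiv ℝ f p (Pi.single μ 1)

/-- The Levi-Civita symbol, with `ε_{0123} = 1`. -/
def eps (i j k l : Fin 4) : ℤ :=
  Int.sign ((j : ℤ) - i) * Int.sign ((k : ℤ) - i) * Int.sign ((l : ℤ) - i) *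
    Int.sign ((k : ℤ) - j) * Int.sign ((l : ℤ) - j) * Int.sign ((l : ℤ) - k)

/-- The three basic fields of a metric-affine geometry on a coordinate chart:
* `met p a b` is the anholonomic metric `g_{ab}`;
* `cof p μ a` is the component `e_μ^a` of the coframe `ϑ^a = e_μ^a dx^μ`;
* `con p μ a b` is the component `Γ_{μ a}^b` of the connection 1-form `Γ_a^b = Γ_{μ a}^b dx^μ`. -/
structure Fields where
  met : Pt → Matrix (Fin 4) (Fin 4) ℝ
  cof : Pt → Matrix (Fin 4) (Fin 4) ℝ
  con : Pt → Fin 4 → Fin 4 → Fin 4 → ℝ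

namespace Fields

/-- All components of the three fields are smooth on `U`. -/
def SmoothOn (F : Fields) (U : Set Pt) : Prop :=
  (∀ a b, ContDiffOn ℝ ∞ (fun p => F.met p a b) U) ∧
  (∀ μ a, ContDiffOn ℝ ∞ (fun p => F.cof p μ a) U) ∧
  (∀ μ a b, ContDiffOn ℝ ∞ (fun p => F.con p μ a b) U)

/-- The coordinate metric `g_{μν} = e_μ^a e_ν^b g_{ab}`. -/
def g (F : Fields) (p : Pt) : Matrix (Fin 4) (Fin 4) ℝ :=
  F.cof p * F.met p * (F.cof p).transpose

/-- The inverse coordinate metric `g^{μν}`. -/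
def gInv (F : Fields) (p : Pt) : Matrix (Fin 4) (Fin 4) ℝ := (F.g p)⁻¹

/-- The inverse anholonomic metric `g^{ab}`. -/
def metInv (F : Fields) (p : Pt) : Matrix (Fin 4) (Fin 4) ℝ := (F.met p)⁻¹

/-- The frame `e_a = e^μ_a ∂_μ` dual to the coframe; `frame p a μ` is `e^μ_a`. -/
def frame (F : Fields) (p : Pt) : Matrix (Fin 4) (Fin 4) ℝ := (F.cof p)⁻¹

/-- The Levi-Civita tensor (components of the volume form) `√|det g| ε_{μνρσ}`. -/
def vol (F : Fields) (p : Pt) (μ ν ρ σ : Fin 4) : ℝ :=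
  Real.sqrt |(F.g p).det| * (eps μ ν ρ σ : ℝ)

/-- Hodge dual of a 1-form: components `(⋆α)_{νρσ} = α^μ ℰ_{μνρσ}`. -/
def star1 (F : Fields) (p : Pt) (α : Fin 4 → ℝ) (ν ρ σ : Fin 4) : ℝ :=
  ∑ μ, ∑ τ, F.gInv p μ τ * α τ * F.vol p μ ν ρ σ

/-- Hodge dual of a 2-form: components `(⋆α)_{ρσ} = ½ α^{μν} ℰ_{μνρσ}`. -/
def star2 (F : Fields) (p : Pt) (α : Fin 4 → Fin 4 → ℝ) (ρ σ : Fin 4) : ℝ :=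
  (1 / 2) * ∑ μ, ∑ ν, ∑ τ, ∑ κ, F.gInv p μ τ * F.gInv p ν κ * α τ κ * F.vol p μ ν ρ σ

/-- The interior product `e^a ⌟ C = g^{ab} e_b ⌟ C` of a 3-form `C`. -/
def interior3 (F : Fields) (p : Pt) (a : Fin 4) (C : Fin 4 → Fin 4 → Fin 4 → ℝ)
    (μ ν : Fin 4) : ℝ :=
  ∑ b, ∑ ρ, F.metInv p a b * F.frame p b ρ * C ρ μ ν

/-- Torsion components: `T^a = Dϑ^a = dϑ^a + Γ_c^a ∧ ϑ^c = ½ T_{μν}^a dx^μ ∧ dx^ν`. -/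
def torsion (F : Fields) (p : Pt) (μ ν a : Fin 4) : ℝ :=
  pd μ (fun q => F.cof q ν a) p - pd ν (fun q => F.cof q μ a) p +
    ∑ c, (F.con p μ c a * F.cof p ν c - F.con p ν c a * F.cof p μ c)

/-- Nonmetricity components: `Q_{ab} = -D g_{ab} = Q_{μab} dx^μ`. -/
def nonmetricity (F : Fields) (p : Pt) (μ a b : Fin 4) : ℝ :=
  -(pd μ (fun q => F.met q a b) p -
      ∑ c, (F.con p μ a c * F.met p c b + F.con p μ b c * F.met p a c))

/-- Curvature components: `R_a^b = dΓ_a^b + Γ_c^b ∧ Γ_a^c = ½ R_{μν a}^b dx^μ ∧ dx^ν`. -/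
def curvature (F : Fields) (p : Pt) (μ ν a b : Fin 4) : ℝ :=
  pd μ (fun q => F.con q ν a b) p - pd ν (fun q => F.con q μ a b) p +
    ∑ c, (F.con p μ c b * F.con p ν a c - F.con p ν c b * F.con p μ a c)

/-- The Ricci tensor `Ric = R_{acb}^c ϑ^a ⊗ ϑ^b` of the connection, in frame components. -/
def ricci (F : Fields) (p : Pt) (a b : Fin 4) : ℝ :=
  ∑ c, ∑ μ, ∑ ν, F.frame p a μ * F.frame p c ν * F.curvature p μ ν b c

/-- Christoffel symbols `½ g^{ρσ} (∂_μ g_{σν} + ∂_ν g_{σμ} - ∂_σ g_{μν})` of the coordinate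
metric. -/
def christoffel (F : Fields) (p : Pt) (μ ν ρ : Fin 4) : ℝ :=
  (1 / 2) * ∑ σ, F.gInv p ρ σ *
    (pd μ (fun q => F.g q σ ν) p + pd ν (fun q => F.g q σ μ) p - pd σ (fun q => F.g q μ ν) p)

/-- The Levi-Civita connection in the frame `e_a`, from `∇̊_μ e_a = Γ̊_{μ a}^b e_b`. -/
def leviCivita (F : Fields) (p : Pt) (μ a b : Fin 4) : ℝ :=
  ∑ ρ, (pd μ (fun q => F.frame q a ρ) p + ∑ ν, christoffel F p μ ν ρ * F.frame p a ν) *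
    F.cof p ρ b

/-- The first variation is taken along `F + t • δ`. -/
def vary (F δ : Fields) (t : ℝ) : Fields where
  met := fun p => F.met p + t • δ.met p
  cof := fun p => F.cof p + t • δ.cof p
  con := fun p => F.con p + t • δ.con p

/-- The component along `du ∧ dv ∧ dx ∧ dy` of the Lagrangian 4-form
`-1/(2ρ) R_a^b ∧ ⋆ R_b^a`. -/
def ymLagrangian (ρ : ℝ) (F : Fields) (p : Pt) : ℝ :=
  -(1 / (2 * ρ)) * ∑ a, ∑ b, (1 / 4) * ∑ μ, ∑ ν, ∑ σ, ∑ τ, (eps μ ν σ τ : ℝ) *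
    F.curvature p μ ν a b * F.star2 p (fun κ l => F.curvature p κ l b a) σ τ

/-- The action of the Yang–Mills-like Lagrangian over a region `K`. -/
def ymAction (ρ : ℝ) (K : Set Pt) (F : Fields) : ℝ :=
  ∫ p in K, ymLagrangian ρ F p

/-- `δ` is an admissible variation of the fields: smooth, supported in `K`, and with symmetric
metric part. -/
structure IsVariation (δ : Fields) (K : Set Pt) : Prop where
  smooth : δ.SmoothOn Set.univ
  symm : ∀ p a b, δ.met p a b = δ.met p b a
  supp : ∀ p, p ∉ K → δ.met p = 0 ∧ δ.cof p = 0 ∧ δ.con p = 0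

/-- The vacuum equations of motion on `U`: the action is stationary under all compactly supported
independent variations of the metric, the coframe and the connection. -/
def YMEquationsOfMotion (ρ : ℝ) (F : Fields) (U : Set Pt) : Prop :=
  ∀ (K : Set Pt) (δ : Fields), IsCompact K → K ⊆ U → δ.IsVariation K →
    HasDerivAt (fun t : ℝ => ymAction ρ K (F.vary δ t)) 0 0

end Fields

/-- The covariant derivative `(∇_μ S)_{ab} = ∂_μ S_{ab} - Γ_{μ a}^c S_{cb} - Γ_{μ b}^c S_{ac}`. -/
def covDeriv (Γ : Pt → Fin 4 → Fin 4 → Fin 4 → ℝ) (S : Pt → Fin 4 → Fin 4 → ℝ)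
    (p : Pt) (μ a b : Fin 4) : ℝ :=
  pd μ (fun q => S q a b) p - ∑ c, (Γ p μ a c * S p c b + Γ p μ b c * S p a c)

/-- The pp-wave metric `H(u,x,y) du² + 2 du dv - dx² - dy²`. -/
def ppMetric (H : ℝ × ℝ × ℝ → ℝ) (p : Pt) : Matrix (Fin 4) (Fin 4) ℝ :=
  !![H (p 0, p 2, p 3), 1, 0, 0;
     1, 0, 0, 0;
     0, 0, -1, 0;
     0, 0, 0, -1]

/-- The transversal Laplacian `(∂_x² + ∂_y²) H`. -/
def transLaplacian (H : ℝ × ℝ × ℝ → ℝ) (p : Pt) : ℝ :=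
  pd 2 (pd 2 (fun q => H (q 0, q 2, q 3))) p + pd 3 (pd 3 (fun q => H (q 0, q 2, q 3))) p

/-- The axial 1-form `𝒜(φ) du` with phase `φ = u + φ₀`. -/
def axialForm (A : ℝ → ℝ) (φ₀ : ℝ) (p : Pt) (μ : Fin 4) : ℝ :=
  if μ = 0 then A (p 0 + φ₀) else 0

end

end MAG

/-! In the coordinate frame, metric compatibility and the prescribed torsion determine the
connection by the Koszul argument: it is the Levi-Civita connection plus a totally antisymmetric
contortion of size `A/6` (`coordCon_lowered`, `coordCon_eq`). Two features of it drive everything.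

The 1-form `du` is parallel, for this connection (`pd_frame`) and for the Levi-Civita one
(`pd_frame_leviCivita`). The Ricci tensor is `f du ⊗ du` with `f = -½(ΔH - A²/9)`, where `Δ = ∂_x² +
∂_y²` (`ricci_eq`, `waveRicci_eq`). Hence both covariant derivatives equal `df ⊗ du ⊗ du`
(`covDeriv_ricci`), and on a connected set this vanishes exactly when `f` is constant.

The curvature has only the components `R_{ux}` and `R_{uy}`, up to antisymmetry, with values in
commuting null rotations, any two of which have traceless product (`trace_frameCurv_mul`). The
Lagrangian is a sum of weights, built from metric and coframe, times traces `tr(R R)`. All these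
traces vanish on the wave, so varying the weights contributes nothing to first order and only the
variation of the connection remains. Its contribution is a total divergence provided that `R` does
not depend on `v` and `∂_x R_{ux} + ∂_y R_{uy} = 0` up to commutators with the connection. The
entries of that divergence are `-½ ∂_x ΔH` and `-½ ∂_y ΔH`, which vanish when `f` is constant
because `A` depends on `u` alone (`div_coordCurv`). A divergence with compact support integrates to
zero, and differentiation under the integral sign concludes. -/

namespace MAG

open Topology Matrix

/-! ### Partial derivatives on the chart. -/

section Calculus

variable {f g : Pt → ℝ} {p : Pt} {U : Set Pt} {μ ν : Fin 4}

theorem pd_congr (h : f =ᶠ[𝓝 p] g) : pd μ f p = pd μ g p := by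
  unfold pd; rw [h.fderiv_eq]

theorem pd_congr_on (hU : IsOpen U) (hp : p ∈ U) (h : ∀ q ∈ U, f q = g q) :
    pd μ f p = pd μ g p :=
  pd_congr (Filter.eventually_of_mem (hU.mem_nhds hp) h)

@[simp] theorem pd_const (c : ℝ) : pd μ (fun _ => c) p = 0 := by
  simp [pd]

theorem pd_add (hf : DifferentiableAt ℝ f p) (hg : DifferentiableAt ℝ g p) :
    pd μ (fun q => f q + g q) p = pd μ f p + pd μ g p := by
  simp [pd, fderiv_fun_add hf hg]

theorem pd_sub (hf : DifferentiableAt ℝ f p) (hg : DifferentiableAt ℝ g p) :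
    pd μ (fun q => f q - g q) p = pd μ f p - pd μ g p := by
  simp [pd, fderiv_fun_sub hf hg]

theorem pd_neg : pd μ (fun q => -f q) p = -pd μ f p := by
  simp [pd, fderiv_fun_neg]

theorem pd_mul (hf : DifferentiableAt ℝ f p) (hg : DifferentiableAt ℝ g p) :
    pd μ (fun q => f q * g q) p = pd μ f p * g p + f p * pd μ g p := by
  simp [pd, fderiv_fun_mul hf hg]; ring

theorem pd_const_mul (c : ℝ) (hf : DifferentiableAt ℝ f p) :
    pd μ (fun q => c * f q) p = c * pd μ f p := by
  simp [pd, fderiv_const_mul hf]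

theorem pd_sum {ι : Type*} {s : Finset ι} {F : ι → Pt → ℝ}
    (hF : ∀ i ∈ s, DifferentiableAt ℝ (F i) p) :
    pd μ (fun q => ∑ i ∈ s, F i q) p = ∑ i ∈ s, pd μ (F i) p := by
  simp [pd, fderiv_fun_sum hF]

theorem contDiffOn_pd (hU : IsOpen U) (hf : ContDiffOn ℝ ∞ f U) (μ : Fin 4) :
    ContDiffOn ℝ ∞ (pd μ f) U :=
  (hf.fderiv_of_isOpen (m := ∞) hU (by simp)).clm_apply contDiffOn_const

theorem differentiableAt_of_smoothOn (hU : IsOpen U) (hf : ContDiffOn ℝ ∞ f U) (hp : p ∈ U) :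
    DifferentiableAt ℝ f p :=
  (hf.contDiffAt (hU.mem_nhds hp)).differentiableAt (by simp)

theorem pd_comm (hU : IsOpen U) (hf : ContDiffOn ℝ ∞ f U) (hp : p ∈ U) (μ ν : Fin 4) :
    pd μ (pd ν f) p = pd ν (pd μ f) p := by
  have hs : IsSymmSndFDerivAt ℝ f p :=
    (hf.contDiffAt (hU.mem_nhds hp)).isSymmSndFDerivAt (by simp; exact WithTop.coe_le_coe.2 (le_top : (2 : ℕ∞) ≤ ⊤))
  have hd : DifferentiableAt ℝ (fderiv ℝ f) p :=
    ((hf.fderiv_of_isOpen (m := ∞) hU (by simp)).contDiffAt (hU.mem_nhds hp)).differentiableAt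
      (by simp)
  have key : ∀ α β : Fin 4, pd α (pd β f) p
      = fderiv ℝ (fderiv ℝ f) p (Pi.single α 1) (Pi.single β 1) := by
    intro α β
    unfold pd
    rw [fderiv_clm_apply hd (differentiableAt_const _)]
    simp
  rw [key, key]
  exact hs.eq _ _

/-- A function that does not depend on the coordinate `μ` has vanishing derivative along it. -/
theorem pd_eq_zero_of_update (h : ∀ q s, f (Function.update q μ s) = f q) : pd μ f p = 0 := by
  by_cases hf : DifferentiableAt ℝ f p
  · have h1 := hf.lineDeriv_eq_fderiv (v := Pi.single μ 1)
    unfold pd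
    rw [← h1, lineDeriv]
    have : (fun t : ℝ => f (p + t • Pi.single μ 1)) = fun _ => f p := by
      funext t
      rw [← h p (p μ + t)]
      congr 1
      funext i
      by_cases hi : i = μ
      · subst hi; simp
      · simp [hi]
    rw [this]; simp
  -- At a point of non-differentiability `fderiv` has the default value zero, so no smoothness is
  -- needed.
  · simp [pd, fderiv_zero_of_not_differentiableAt hf]

/-- A function all of whose partial derivatives vanish on a preconnected open set is constant. -/
theorem exists_const_of_pd_eq_zero (hU : IsOpen U) (hUc : IsPreconnected U)
    (hf : ContDiffOn ℝ ∞ f U) (h : ∀ p ∈ U, ∀ μ, pd μ f p = 0) :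
    ∃ C, ∀ p ∈ U, f p = C := by
  refine hU.exists_is_const_of_fderiv_eq_zero hUc (hf.differentiableOn (by simp)) ?_
  intro p hp
  ext v
  have : v = ∑ i, v i • (Pi.single i 1 : Pt) := by
    funext j
    simp [Finset.sum_apply, Pi.single_apply]
  rw [this, map_sum]
  simp only [map_smul]
  have h' : ∀ μ, fderiv ℝ f p (Pi.single μ 1) = 0 := h p hp
  simp [h']

end Calculus

/-! ### Smooth matrix-valued functions. -/

section MatrixFunctions

variable {E : Type*} [NormedAddCommGroup E] [NormedSpace ℝ E]

/-- All entries of the matrix function `M` are smooth on `s`. -/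
def SmoothMat (M : E → Matrix (Fin 4) (Fin 4) ℝ) (s : Set E) : Prop :=
  ∀ i j, ContDiffOn ℝ ∞ (fun p => M p i j) s

variable {M N : E → Matrix (Fin 4) (Fin 4) ℝ} {s : Set E}

theorem SmoothMat.congr (hM : SmoothMat M s) (h : ∀ p ∈ s, N p = M p) : SmoothMat N s :=
  fun i j => (hM i j).congr fun p hp => by rw [h p hp]

theorem SmoothMat.mul (hM : SmoothMat M s) (hN : SmoothMat N s) :
    SmoothMat (fun p => M p * N p) s := fun i j => by
  simp only [Matrix.mul_apply]
  exact ContDiffOn.sum fun k _ => (hM i k).mul (hN k j)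

theorem SmoothMat.add (hM : SmoothMat M s) (hN : SmoothMat N s) :
    SmoothMat (fun p => M p + N p) s := fun i j => (hM i j).add (hN i j)

theorem SmoothMat.sub (hM : SmoothMat M s) (hN : SmoothMat N s) :
    SmoothMat (fun p => M p - N p) s := fun i j => (hM i j).sub (hN i j)

theorem SmoothMat.transpose (hM : SmoothMat M s) : SmoothMat (fun p => (M p)ᵀ) s :=
  fun i j => hM j i

theorem SmoothMat.det (hM : SmoothMat M s) : ContDiffOn ℝ ∞ (fun p => (M p).det) s := by
  simp only [Matrix.det_apply']
  exact ContDiffOn.sum fun σ _ => contDiffOn_const.mul (contDiffOn_prod fun i _ => hM _ _)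

theorem SmoothMat.adjugate (hM : SmoothMat M s) : SmoothMat (fun p => (M p).adjugate) s := by
  intro i j
  simp only [Matrix.adjugate_apply]
  refine SmoothMat.det (M := fun p => (M p).updateRow j (Pi.single i 1)) fun k l => ?_
  by_cases hk : k = j
  · subst hk; simp only [Matrix.updateRow_self]; exact contDiffOn_const
  · simp only [Matrix.updateRow_ne hk]; exact hM k l

theorem SmoothMat.inv (hM : SmoothMat M s) (h : ∀ p ∈ s, (M p).det ≠ 0) :
    SmoothMat (fun p => (M p)⁻¹) s := by
  intro i j
  simp only [Matrix.inv_def, Ring.inverse_eq_inv', Matrix.smul_apply, smul_eq_mul]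
  exact (hM.det.inv h).mul (hM.adjugate i j)

theorem SmoothMat.trace_mul (hM : SmoothMat M s) (hN : SmoothMat N s) :
    ContDiffOn ℝ ∞ (fun p => (M p * N p).trace) s := by
  simp only [Matrix.trace, Matrix.diag]
  exact ContDiffOn.sum fun i _ => hM.mul hN i i

end MatrixFunctions

/-! ### Matrix derivatives and gauge covariance of the curvature. -/

section MatrixCalculus

variable {M N : Pt → Matrix (Fin 4) (Fin 4) ℝ} {p : Pt} {U : Set Pt} {μ ν : Fin 4}

/-- The entrywise partial derivative of a matrix function. -/
noncomputable def pdM (μ : Fin 4) (M : Pt → Matrix (Fin 4) (Fin 4) ℝ) (p : Pt) :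
    Matrix (Fin 4) (Fin 4) ℝ :=
  Matrix.of fun i j => pd μ (fun q => M q i j) p

@[simp] theorem pdM_apply (i j : Fin 4) : pdM μ M p i j = pd μ (fun q => M q i j) p := rfl

theorem SmoothMat.pdM (hU : IsOpen U) (hM : SmoothMat M U) (μ : Fin 4) :
    SmoothMat (pdM μ M) U := fun i j => contDiffOn_pd hU (hM i j) μ

theorem SmoothMat.differentiableAt (hU : IsOpen U) (hM : SmoothMat M U) (hp : p ∈ U)
    (i j : Fin 4) : DifferentiableAt ℝ (fun q => M q i j) p :=
  differentiableAt_of_smoothOn hU (hM i j) hp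

theorem pdM_congr_on (hU : IsOpen U) (hp : p ∈ U) (h : ∀ q ∈ U, M q = N q) :
    pdM μ M p = pdM μ N p := by
  ext i j
  exact pd_congr_on hU hp fun q hq => by rw [h q hq]

theorem pdM_sub (hU : IsOpen U) (hM : SmoothMat M U) (hN : SmoothMat N U) (hp : p ∈ U) :
    pdM μ (fun q => M q - N q) p = pdM μ M p - pdM μ N p := by
  ext i j
  exact pd_sub (hM.differentiableAt hU hp i j) (hN.differentiableAt hU hp i j)

theorem pdM_mul (hU : IsOpen U) (hM : SmoothMat M U) (hN : SmoothMat N U) (hp : p ∈ U) :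
    pdM μ (fun q => M q * N q) p = pdM μ M p * N p + M p * pdM μ N p := by
  ext i j
  simp only [pdM_apply, Matrix.mul_apply, Matrix.add_apply]
  rw [pd_sum (F := fun k q => M q i k * N q k j) fun k _ =>
    (hM.differentiableAt hU hp i k).fun_mul (hN.differentiableAt hU hp k j),
    ← Finset.sum_add_distrib]
  exact Finset.sum_congr rfl fun k _ =>
    pd_mul (hM.differentiableAt hU hp i k) (hN.differentiableAt hU hp k j)

theorem pdM_transpose : pdM μ (fun q => (M q)ᵀ) p = (pdM μ M p)ᵀ := rfl

theorem pd_trace (hU : IsOpen U) (hM : SmoothMat M U) (hp : p ∈ U) :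
    pd μ (fun q => (M q).trace) p = (pdM μ M p).trace := by
  simp only [Matrix.trace, Matrix.diag]
  exact pd_sum fun i _ => hM.differentiableAt hU hp i i

theorem pdM_comm (hU : IsOpen U) (hM : SmoothMat M U) (hp : p ∈ U) (μ ν : Fin 4) :
    pdM μ (pdM ν M) p = pdM ν (pdM μ M) p := by
  ext i j
  exact pd_comm hU (hM i j) hp μ ν

theorem pdM_inv (hU : IsOpen U) (hM : SmoothMat M U) (hdet : ∀ q ∈ U, (M q).det ≠ 0)
    (hp : p ∈ U) :
    pdM μ (fun q => (M q)⁻¹) p = -((M p)⁻¹ * pdM μ M p * (M p)⁻¹) := by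
  have hu : IsUnit (M p).det := (hdet p hp).isUnit
  have h1 : pdM μ (fun q => (M q)⁻¹ * M q) p = 0 := by
    rw [pdM_congr_on (N := fun _ => 1) hU hp
      fun q hq => Matrix.nonsing_inv_mul _ (hdet q hq).isUnit]
    ext i j; simp
  rw [pdM_mul hU (hM.inv hdet) hM hp] at h1
  have h2 := congrArg (· * (M p)⁻¹) h1
  simp only [add_mul, Matrix.mul_assoc, Matrix.mul_nonsing_inv _ hu, mul_one, zero_mul] at h2
  rw [eq_neg_iff_add_eq_zero, Matrix.mul_assoc]
  exact h2

/-- The curvature matrices `R_{μν}` of the connection matrices `G_μ`. -/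
noncomputable def matCurv (G : Fin 4 → Pt → Matrix (Fin 4) (Fin 4) ℝ) (μ ν : Fin 4) (p : Pt) :
    Matrix (Fin 4) (Fin 4) ℝ :=
  pdM μ (G ν) p - pdM ν (G μ) p + (G ν p * G μ p - G μ p * G ν p)

theorem matCurv_antisymm (G : Fin 4 → Pt → Matrix (Fin 4) (Fin 4) ℝ) (μ ν : Fin 4) (p : Pt) :
    matCurv G μ ν p = -matCurv G ν μ p := by
  unfold matCurv; abel

/-- Gauge covariance of the curvature. -/
theorem matCurv_gauge (hU : IsOpen U) {G Γ : Fin 4 → Pt → Matrix (Fin 4) (Fin 4) ℝ}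
    {e : Pt → Matrix (Fin 4) (Fin 4) ℝ} (he : SmoothMat e U) (hG : ∀ μ, SmoothMat (G μ) U)
    (hΓ : ∀ μ, SmoothMat (Γ μ) U)
    (h : ∀ μ, ∀ q ∈ U, pdM μ e q = G μ q * e q - e q * Γ μ q) (hp : p ∈ U) (μ ν : Fin 4) :
    matCurv G μ ν p * e p = e p * matCurv Γ μ ν p := by
  have key : ∀ α β, pdM α (pdM β e) p = pdM α (G β) p * e p + G β p * (G α p * e p - e p * Γ α p)
      - ((G α p * e p - e p * Γ α p) * Γ β p + e p * pdM α (Γ β) p) := by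
    intro α β
    rw [pdM_congr_on hU hp (h β), pdM_sub hU ((hG β).mul he) (he.mul (hΓ β)) hp,
      pdM_mul hU (hG β) he hp, pdM_mul hU he (hΓ β) hp, h α p hp]
  -- The mixed second derivatives of `e` agree; after the transformation law is inserted twice,
  -- their difference is exactly the claimed identity.
  have hc := pdM_comm hU he hp μ ν
  rw [key, key] at hc
  unfold matCurv
  rw [← sub_eq_zero] at hc ⊢
  rw [← hc]
  noncomm_ring

/-- Gauge covariance of the derivative of an endomorphism `e⁻¹ M e`. -/
theorem pdM_conj (hU : IsOpen U) {G Γ : Fin 4 → Pt → Matrix (Fin 4) (Fin 4) ℝ}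
    {e M N : Pt → Matrix (Fin 4) (Fin 4) ℝ} (he : SmoothMat e U) (hM : SmoothMat M U)
    (hN : SmoothMat N U) (hdet : ∀ q ∈ U, (e q).det ≠ 0)
    (h : ∀ μ, ∀ q ∈ U, pdM μ e q = G μ q * e q - e q * Γ μ q)
    (hMN : ∀ q ∈ U, M q * e q = e q * N q) (hp : p ∈ U) (μ : Fin 4) :
    pdM μ N p = Γ μ p * N p - N p * Γ μ p +
      (e p)⁻¹ * (pdM μ M p - G μ p * M p + M p * G μ p) * e p := by
  have h1 := pdM_congr_on (μ := μ) hU hp hMN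
  rw [pdM_mul hU hM he hp, pdM_mul hU he hN hp, h μ p hp] at h1
  have hu : IsUnit (e p).det := (hdet p hp).isUnit
  have h3 : (e p)⁻¹ * (e p) = 1 := Matrix.nonsing_inv_mul _ hu
  have hMN' := hMN p hp
  have h5 : pdM μ N p = (e p)⁻¹ * (e p * pdM μ N p) := by rw [← Matrix.mul_assoc, h3, one_mul]
  have h6 : e p * pdM μ N p = pdM μ M p * e p + M p * (G μ p * e p - e p * Γ μ p)
      - (G μ p * e p - e p * Γ μ p) * N p := by rw [h1]; abel
  have h7 : M p * (e p * Γ μ p) = e p * (N p * Γ μ p) := by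
    rw [← Matrix.mul_assoc, hMN', Matrix.mul_assoc]
  have h8 : G μ p * e p * N p = G μ p * M p * e p := by
    rw [Matrix.mul_assoc, ← hMN', Matrix.mul_assoc]
  have h9 : pdM μ M p * e p + M p * (G μ p * e p - e p * Γ μ p) - (G μ p * e p - e p * Γ μ p) * N p
      = e p * (Γ μ p * N p - N p * Γ μ p) + (pdM μ M p - G μ p * M p + M p * G μ p) * e p := by
    rw [mul_sub, sub_mul, h7, h8]
    noncomm_ring
  rw [h5, h6, h9, mul_add, ← Matrix.mul_assoc, h3, one_mul, ← Matrix.mul_assoc ((e p)⁻¹)]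

end MatrixCalculus

/-! ### From the anholonomic frame to the coordinate frame. -/

noncomputable section

namespace Fields

variable (F : Fields)

/-- The connection matrices `(Γ_μ)_a^b`. -/
def conMat (μ : Fin 4) (p : Pt) : Matrix (Fin 4) (Fin 4) ℝ := Matrix.of (F.con p μ)

/-- The connection coefficients in the coordinate frame. -/
def coordCon (μ : Fin 4) (p : Pt) : Matrix (Fin 4) (Fin 4) ℝ :=
  (pdM μ F.cof p + F.cof p * F.conMat μ p) * (F.cof p)⁻¹

theorem curvature_eq_matCurv (p : Pt) (μ ν a b : Fin 4) :
    F.curvature p μ ν a b = matCurv F.conMat μ ν p a b := by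
  simp only [curvature, matCurv, Matrix.add_apply, Matrix.sub_apply, pdM_apply, Matrix.mul_apply,
    conMat, Matrix.of_apply, ← Finset.sum_sub_distrib]
  congr 1
  exact Finset.sum_congr rfl fun c _ => by ring

theorem g_eq (p : Pt) : F.g p = F.cof p * F.met p * (F.cof p)ᵀ := rfl

variable {F} {p : Pt} {U : Set Pt}

/-- The gauge transformation law relating the two connection matrices, in the form required by
`matCurv_gauge` and `pdM_conj`. -/
theorem pdM_cof (h : (F.cof p).det ≠ 0) (μ : Fin 4) :
    pdM μ F.cof p = F.coordCon μ p * F.cof p - F.cof p * F.conMat μ p := by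
  rw [coordCon, Matrix.mul_assoc, Matrix.nonsing_inv_mul _ h.isUnit, mul_one, add_sub_cancel_right]

/-- The derivatives of the coframe are absorbed by the change of frame, so torsion becomes the
antisymmetric part of the coordinate connection. -/
theorem torsion_eq (h : (F.cof p).det ≠ 0) (μ ν a : Fin 4) :
    F.torsion p μ ν a = (F.coordCon μ p * F.cof p) ν a - (F.coordCon ν p * F.cof p) μ a := by
  have e : ∀ α, F.coordCon α p * F.cof p = pdM α F.cof p + F.cof p * F.conMat α p := fun α => by
    rw [pdM_cof h, sub_add_cancel]
  rw [e, e]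
  simp only [torsion, Matrix.add_apply, pdM_apply, Matrix.mul_apply, conMat, Matrix.of_apply,
    Finset.sum_sub_distrib]
  simp only [mul_comm (F.cof p _ _)]
  ring

theorem pdM_met (h : ∀ μ a b, F.nonmetricity p μ a b = 0) (μ : Fin 4) :
    pdM μ F.met p = F.conMat μ p * F.met p + F.met p * (F.conMat μ p)ᵀ := by
  ext a b
  have h1 := h μ a b
  simp only [nonmetricity, neg_eq_zero, sub_eq_zero] at h1
  rw [pdM_apply, h1]
  simp only [Matrix.add_apply, Matrix.mul_apply, Matrix.transpose_apply, conMat, Matrix.of_apply,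
    ← Finset.sum_add_distrib]
  exact Finset.sum_congr rfl fun c _ => by ring

theorem SmoothOn.cof (hF : F.SmoothOn U) : SmoothMat F.cof U := hF.2.1

theorem SmoothOn.met (hF : F.SmoothOn U) : SmoothMat F.met U := hF.1

theorem SmoothOn.conMat (hF : F.SmoothOn U) (μ : Fin 4) : SmoothMat (F.conMat μ) U := hF.2.2 μ

theorem SmoothOn.coordCon (hU : IsOpen U) (hF : F.SmoothOn U)
    (hdet : ∀ q ∈ U, (F.cof q).det ≠ 0) (μ : Fin 4) : SmoothMat (F.coordCon μ) U :=
  ((hF.cof.pdM hU μ).add (hF.cof.mul (hF.conMat μ))).mul (hF.cof.inv hdet)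

theorem pdM_g (hU : IsOpen U) (hF : F.SmoothOn U) (hp : p ∈ U) (hdet : (F.cof p).det ≠ 0)
    (h : ∀ μ a b, F.nonmetricity p μ a b = 0) (μ : Fin 4) :
    pdM μ F.g p = F.coordCon μ p * F.g p + F.g p * (F.coordCon μ p)ᵀ := by
  have : F.g = fun q => F.cof q * F.met q * (F.cof q)ᵀ := rfl
  rw [this, pdM_mul hU (hF.cof.mul hF.met) hF.cof.transpose hp, pdM_mul hU hF.cof hF.met hp,
    pdM_transpose, pdM_cof hdet, pdM_met h]
  simp only [Matrix.transpose_mul, Matrix.transpose_sub]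
  noncomm_ring

end Fields

/-- The profile `H(u, x, y)` as a function on the chart. -/
def profile (H : ℝ × ℝ × ℝ → ℝ) (p : Pt) : ℝ := H (p 0, p 2, p 3)

/-- One sixth of the axial amplitude, the size of the contortion. -/
def amplitude (A : ℝ → ℝ) (φ₀ : ℝ) (p : Pt) : ℝ := (1 / 6) * A (p 0 + φ₀)

theorem pd_profile_one (H : ℝ × ℝ × ℝ → ℝ) : pd 1 (profile H) = fun _ => 0 := by
  funext p
  exact pd_eq_zero_of_update fun q s => by simp [profile]

theorem pd_amplitude (A : ℝ → ℝ) (φ₀ : ℝ) {μ : Fin 4} (hμ : μ ≠ 0) :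
    pd μ (amplitude A φ₀) = fun _ => 0 := by
  funext p
  exact pd_eq_zero_of_update fun q s => by simp [amplitude, hμ.symm]

/-- A metric-compatible geometry on `U` with pp-wave metric and axial torsion. -/
structure IsAxialWave (F : Fields) (U : Set Pt) (H : ℝ × ℝ × ℝ → ℝ) (A : ℝ → ℝ) (φ₀ : ℝ) :
    Prop where
  isOpen : IsOpen U
  profile : ContDiffOn ℝ ∞ (profile H) U
  amplitude : ContDiffOn ℝ ∞ (amplitude A φ₀) U
  smooth : F.SmoothOn U
  metric : ∀ p ∈ U, F.g p = ppMetric H p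
  compat : ∀ p ∈ U, ∀ μ a b, F.nonmetricity p μ a b = 0
  axial : ∀ p ∈ U, ∀ μ ν a, F.torsion p μ ν a =
    (1 / 3) * F.interior3 p a (F.star1 p (axialForm A φ₀ p)) μ ν

/-- The inverse of the pp-wave metric. -/
def ppMetricInv (H : ℝ × ℝ × ℝ → ℝ) (p : Pt) : Matrix (Fin 4) (Fin 4) ℝ :=
  !![0, 1, 0, 0;
     1, -profile H p, 0, 0;
     0, 0, -1, 0;
     0, 0, 0, -1]

theorem ppMetric_mul_inv (H : ℝ × ℝ × ℝ → ℝ) (p : Pt) : ppMetric H p * ppMetricInv H p = 1 := by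
  ext i j
  fin_cases i <;> fin_cases j <;>
    simp [ppMetric, ppMetricInv, Matrix.mul_apply, Fin.sum_univ_four, profile]

theorem ppMetric_inv (H : ℝ × ℝ × ℝ → ℝ) (p : Pt) : (ppMetric H p)⁻¹ = ppMetricInv H p :=
  Matrix.inv_eq_right_inv (ppMetric_mul_inv H p)

theorem det_ppMetric (H : ℝ × ℝ × ℝ → ℝ) (p : Pt) : (ppMetric H p).det = -1 := by
  simp [ppMetric, Matrix.det_succ_row_zero, Fin.sum_univ_succ, Fin.succAbove]

theorem ppMetric_transpose (H : ℝ × ℝ × ℝ → ℝ) (p : Pt) : (ppMetric H p)ᵀ = ppMetric H p := by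
  ext i j
  fin_cases i <;> fin_cases j <;> rfl

/-- The shape of the connection coefficients of the wave in the coordinate frame. -/
def waveCon (k : Fin 4 → ℝ) (a : ℝ) : Fin 4 → Matrix (Fin 4) (Fin 4) ℝ :=
  ![!![0, 1 / 2 * k 0, 1 / 2 * k 2, 1 / 2 * k 3; 0, 0, 0, 0; 0, 1 / 2 * k 2, 0, a;
      0, 1 / 2 * k 3, -a, 0],
    0,
    !![0, 1 / 2 * k 2, 0, -a; 0, 0, 0, 0; 0, 0, 0, 0; 0, -a, 0, 0],
    !![0, 1 / 2 * k 3, a, 0; 0, 0, 0, 0; 0, a, 0, 0; 0, 0, 0, 0]]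

/-- The null rotations, in which the curvature takes its values. -/
def nullMat (s w : ℝ) : Matrix (Fin 4) (Fin 4) ℝ :=
  !![0, 0, s, w; 0, 0, 0, 0; 0, s, 0, 0; 0, w, 0, 0]

/-- This says that `du` is parallel. -/
theorem waveCon_col_zero (k : Fin 4 → ℝ) (a : ℝ) (μ ν : Fin 4) : waveCon k a μ ν 0 = 0 := by
  fin_cases μ <;> fin_cases ν <;> simp [waveCon]

/-- The product of two null rotations is a multiple of the matrix unit `E₀₁`, hence traceless. -/
theorem trace_nullMat_mul (s w s' w' : ℝ) : (nullMat s w * nullMat s' w').trace = 0 := by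
  simp [nullMat, Matrix.trace, Matrix.diag, Matrix.mul_apply, Fin.sum_univ_four]

/-- For `i ≠ 0` the connection matrix is a null rotation plus a multiple of `E₀₁`. Null rotations
commute with one another, and their products with `E₀₁` vanish on either side. -/
theorem waveCon_comm_nullMat (k : Fin 4 → ℝ) (a s w : ℝ) {i : Fin 4} (hi : i ≠ 0) :
    waveCon k a i * nullMat s w = nullMat s w * waveCon k a i := by
  ext μ ν
  fin_cases i
  · exact absurd rfl hi
  all_goals fin_cases μ <;> fin_cases ν <;>
    simp [waveCon, nullMat, Matrix.mul_apply, Fin.sum_univ_four, mul_comm]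

/-! ### The connection of the wave. -/

namespace IsAxialWave

variable {F : Fields} {U : Set Pt} {H : ℝ × ℝ × ℝ → ℝ} {A : ℝ → ℝ} {φ₀ : ℝ}
variable (W : IsAxialWave F U H A φ₀) {p : Pt}
include W

/-- Nondegeneracy of the coframe is inherited from the pp-wave metric, whose determinant is `-1`. -/
theorem det_cof (hp : p ∈ U) : (F.cof p).det ≠ 0 := by
  intro h
  have h1 := congrArg Matrix.det (W.metric p hp)
  rw [det_ppMetric, F.g_eq, Matrix.det_mul, Matrix.det_mul, h] at h1
  norm_num at h1

theorem det_met (hp : p ∈ U) : (F.met p).det ≠ 0 := by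
  intro h
  have h1 := congrArg Matrix.det (W.metric p hp)
  rw [det_ppMetric, F.g_eq, Matrix.det_mul, Matrix.det_mul, h] at h1
  norm_num at h1

theorem gInv_eq (hp : p ∈ U) : F.gInv p = ppMetricInv H p := by
  rw [Fields.gInv, W.metric p hp, ppMetric_inv]

theorem g_transpose (hp : p ∈ U) : (F.g p)ᵀ = F.g p := by
  rw [W.metric p hp, ppMetric_transpose]

theorem met_transpose (hp : p ∈ U) : (F.met p)ᵀ = F.met p := by
  have hu : IsUnit (F.cof p).det := (W.det_cof hp).isUnit
  have hu' : IsUnit (F.cof p)ᵀ.det := by rwa [Matrix.det_transpose]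
  have h := W.g_transpose hp
  rw [F.g_eq, Matrix.transpose_mul, Matrix.transpose_mul, Matrix.transpose_transpose,
    ← Matrix.mul_assoc] at h
  have h1 := congrArg (fun X => (F.cof p)⁻¹ * (X * ((F.cof p)ᵀ)⁻¹)) h
  simpa only [Matrix.mul_nonsing_inv_cancel_right _ _ hu', Matrix.nonsing_inv_mul_cancel_left _ _ hu]
    using h1

theorem star1_axial (hp : p ∈ U) (ν ρ σ : Fin 4) :
    F.star1 p (axialForm A φ₀ p) ν ρ σ = A (p 0 + φ₀) * (eps 1 ν ρ σ : ℝ) := by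
  simp [Fields.star1, W.gInv_eq hp, Fields.vol, W.metric p hp, det_ppMetric, axialForm,
    Fin.sum_univ_four, ppMetricInv]

/-- Lowering the frame index undoes the inverse metric and the frame in the interior product,
leaving the components of `⋆(A du)`. The index `1` in `eps` appears because raising the index of
`du` gives `∂_v`; the volume factor is `1`. -/
theorem torsion_lowered (hp : p ∈ U) (μ ν ρ : Fin 4) :
    (F.coordCon μ p * F.g p) ν ρ - (F.coordCon ν p * F.g p) μ ρ =
      1 / 3 * (A (p 0 + φ₀) * (eps 1 ρ μ ν : ℝ)) := by
  have hm : IsUnit (F.met p).det := (W.det_met hp).isUnit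
  have hu : IsUnit (F.cof p).det := (W.det_cof hp).isUnit
  have e : ∀ α β, (F.coordCon α p * F.g p) β ρ
      = ∑ a, (F.coordCon α p * F.cof p) β a * (F.met p * (F.cof p)ᵀ) a ρ := by
    intro α β
    rw [← Matrix.mul_apply, F.g_eq]
    simp only [Matrix.mul_assoc]
  rw [e, e, ← Finset.sum_sub_distrib]
  simp only [← sub_mul, ← Fields.torsion_eq (W.det_cof hp), W.axial p hp]
  set C : Fin 4 → ℝ := fun ρ => F.star1 p (axialForm A φ₀ p) ρ μ ν with hC
  have hi : ∀ a, F.interior3 p a (F.star1 p (axialForm A φ₀ p)) μ ν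
      = ((F.met p)⁻¹ *ᵥ ((F.cof p)⁻¹ *ᵥ C)) a := by
    intro a
    simp only [Fields.interior3, Matrix.mulVec, dotProduct, Fields.metInv, Fields.frame, hC,
      Finset.mul_sum, mul_assoc]
  simp only [hi]
  have hs : ∀ a, (F.met p * (F.cof p)ᵀ) a ρ = (F.cof p * F.met p) ρ a := by
    intro a
    rw [← Matrix.transpose_apply (F.met p * (F.cof p)ᵀ), Matrix.transpose_mul,
      Matrix.transpose_transpose, W.met_transpose hp]
  simp only [hs]
  have h2 : (F.cof p * F.met p) *ᵥ ((F.met p)⁻¹ *ᵥ ((F.cof p)⁻¹ *ᵥ C)) = C := by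
    rw [Matrix.mulVec_mulVec, Matrix.mulVec_mulVec, Matrix.mul_nonsing_inv_cancel_right _ _ hm,
      Matrix.mul_nonsing_inv _ hu, Matrix.one_mulVec]
  have h3 := congrFun h2 ρ
  rw [← W.star1_axial hp]
  change _ = 1 / 3 * C ρ
  rw [← h3]
  simp only [Matrix.mulVec, dotProduct, Finset.mul_sum]
  refine Finset.sum_congr rfl fun a _ => ?_
  simp only [Matrix.mul_apply, ← Finset.mul_sum]
  ring

theorem pd_metric (hp : p ∈ U) (μ ν ρ : Fin 4) :
    pd μ (fun q => F.g q ν ρ) p = if ν = 0 ∧ ρ = 0 then pd μ (MAG.profile H) p else 0 := by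
  rw [pd_congr_on W.isOpen hp (g := fun q => ppMetric H q ν ρ)
    fun q hq => by rw [W.metric q hq]]
  fin_cases ν <;> fin_cases ρ <;> simp [ppMetric]
  rfl

/-- Koszul's argument: three instances each of metric compatibility (`c`) and of the torsion
equation (`t`) are solved for the connection. The torsion terms `A/3` add with equal sign by
antisymmetry of `eps`, and halving them gives `A/6`. -/
theorem coordCon_lowered (hp : p ∈ U) (μ ν ρ : Fin 4) :
    (F.coordCon μ p * F.g p) ν ρ = 1 / 2 * (pd μ (fun q => F.g q ν ρ) p +
      pd ν (fun q => F.g q μ ρ) p - pd ρ (fun q => F.g q μ ν) p) +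
      MAG.amplitude A φ₀ p * (eps 1 μ ν ρ : ℝ) := by
  have c : ∀ α β γ, pd α (fun q => F.g q β γ) p
      = (F.coordCon α p * F.g p) β γ + (F.coordCon α p * F.g p) γ β := by
    intro α β γ
    have h := congrFun (congrFun (Fields.pdM_g W.isOpen W.smooth hp (W.det_cof hp)
      (W.compat p hp) α) β) γ
    have h' : F.g p * (F.coordCon α p)ᵀ = (F.coordCon α p * F.g p)ᵀ := by
      rw [Matrix.transpose_mul, W.g_transpose hp]
    rw [h'] at h
    exact h
  have t := W.torsion_lowered hp
  have s : (eps 1 ρ μ ν : ℝ) = eps 1 μ ν ρ ∧ (eps 1 μ ν ρ : ℝ) = eps 1 ν ρ μ := by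
    have : ∀ μ ν ρ : Fin 4, eps 1 ρ μ ν = eps 1 μ ν ρ := by decide
    exact ⟨by rw [this], by rw [this]⟩
  have t1 := t μ ν ρ
  have t2 := t ν ρ μ
  have t3 := t μ ρ ν
  have s3 : (eps 1 ν μ ρ : ℝ) = -eps 1 μ ν ρ := by
    have : ∀ μ ν ρ : Fin 4, eps 1 ν μ ρ = -eps 1 μ ν ρ := by decide
    rw [this]; push_cast; rfl
  rw [s.1] at t1
  rw [s3] at t3
  rw [c, c, c, MAG.amplitude]
  linarith

theorem coordCon_eq (hp : p ∈ U) (μ : Fin 4) :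
    F.coordCon μ p =
      waveCon (fun i => pd i (MAG.profile H) p) (MAG.amplitude A φ₀ p) μ := by
  have h1 : F.coordCon μ p = F.coordCon μ p * F.g p * ppMetricInv H p := by
    rw [Matrix.mul_assoc, W.metric p hp, ppMetric_mul_inv, mul_one]
  have h0 : pd 1 (MAG.profile H) p = 0 := by rw [pd_profile_one]
  have s2 : Int.sign 2 = 1 := rfl
  have s3 : Int.sign 3 = 1 := rfl
  rw [h1]
  ext ν σ
  rw [Matrix.mul_apply]
  simp only [W.coordCon_lowered hp, W.pd_metric hp,
    Fin.sum_univ_four]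
  fin_cases μ <;> fin_cases ν <;> fin_cases σ <;>
    simp [ppMetricInv, waveCon, eps, h0, s2, s3]

end IsAxialWave

/-- The nonzero components `R_{0i}` of the curvature of the wave, with `k` the Hessian of the
profile, `a` the amplitude and `b` its derivative along `u`. -/
def waveCurv (k : Fin 4 → Fin 4 → ℝ) (a b : ℝ) : Fin 4 → Matrix (Fin 4) (Fin 4) ℝ :=
  ![0, 0,
    nullMat (-(1 / 2) * k 2 2 + a ^ 2) (-(1 / 2) * k 2 3 - b),
    nullMat (-(1 / 2) * k 2 3 + b) (-(1 / 2) * k 3 3 + a ^ 2)]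

/-- The `uu` component of the Ricci tensor of the wave. -/
def waveRicci (H : ℝ × ℝ × ℝ → ℝ) (A : ℝ → ℝ) (φ₀ : ℝ) (p : Pt) : ℝ :=
  -(1 / 2) * transLaplacian H p + 2 * amplitude A φ₀ p ^ 2

theorem transLaplacian_eq (H : ℝ × ℝ × ℝ → ℝ) (p : Pt) :
    transLaplacian H p = pd 2 (pd 2 (profile H)) p + pd 3 (pd 3 (profile H)) p := rfl

theorem waveRicci_eq (H : ℝ × ℝ × ℝ → ℝ) (A : ℝ → ℝ) (φ₀ : ℝ) (p : Pt) :
    waveRicci H A φ₀ p = -(1 / 2) * (transLaplacian H p - 1 / 9 * A (p 0 + φ₀) ^ 2) := by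
  unfold waveRicci amplitude; ring

theorem exists_waveCurv_eq_nullMat (k : Fin 4 → Fin 4 → ℝ) (a b : ℝ) (i : Fin 4) :
    ∃ s w, waveCurv k a b i = nullMat s w := by
  have h : (0 : Matrix (Fin 4) (Fin 4) ℝ) = nullMat 0 0 := by
    ext i j; fin_cases i <;> fin_cases j <;> rfl
  fin_cases i
  exacts [⟨_, _, h⟩, ⟨_, _, h⟩, ⟨_, _, rfl⟩, ⟨_, _, rfl⟩]

set_option maxHeartbeats 1000000 in
/-- The algebraic part of the curvature computation: `K` is the Hessian of the profile and `b` the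
gradient of the amplitude. -/
theorem waveCon_curvature (k : Fin 4 → ℝ) (K : Fin 4 → Fin 4 → ℝ) (a : ℝ) (b : Fin 4 → ℝ)
    (hK : ∀ i j, K i j = K j i) (hK1 : ∀ i, K i 1 = 0) (hb : ∀ i, i ≠ 0 → b i = 0)
    (μ ν : Fin 4) :
    waveCon (K μ) (b μ) ν - waveCon (K ν) (b ν) μ +
        (waveCon k a ν * waveCon k a μ - waveCon k a μ * waveCon k a ν) =
      (if μ = 0 then waveCurv K a (b 0) ν else 0) - (if ν = 0 then waveCurv K a (b 0) μ else 0) := by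
  have h1 : ∀ i, K 1 i = 0 := fun i => by rw [hK, hK1]
  have b1 : b 1 = 0 := hb 1 (by decide)
  have b2 : b 2 = 0 := hb 2 (by decide)
  have b3 : b 3 = 0 := hb 3 (by decide)
  have h20 := hK 2 0
  have h30 := hK 3 0
  have h32 := hK 3 2
  wlog hlt : μ < ν generalizing μ ν
  · rcases eq_or_lt_of_le (not_lt.1 hlt) with h | h
    · subst h
      simp
    · rw [← neg_inj, neg_sub, ← this ν μ h]; abel
  clear hK hK1 hb
  fin_cases μ <;> fin_cases ν
  all_goals first | exact absurd hlt (by decide) | clear hlt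
  all_goals
    ext i j
    fin_cases i <;> fin_cases j <;>
    simp [waveCon, waveCurv, nullMat, h1, b1, b2, b3, h20, h30, h32]
  all_goals ring

/-! ### Curvature and Ricci tensor of the wave; parallel Ricci tensor. -/

namespace IsAxialWave

variable {F : Fields} {U : Set Pt} {H : ℝ × ℝ × ℝ → ℝ} {A : ℝ → ℝ} {φ₀ : ℝ}
variable (W : IsAxialWave F U H A φ₀) {p : Pt}
include W

/-- `waveCon` is linear in its two arguments jointly, so differentiation passes to them. -/
theorem pdM_waveCon (hp : p ∈ U) (μ ν : Fin 4) :
    pdM μ (fun q => waveCon (fun i => pd i (MAG.profile H) q) (MAG.amplitude A φ₀ q) ν) p =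
      waveCon (fun i => pd μ (pd i (MAG.profile H)) p) (pd μ (MAG.amplitude A φ₀) p) ν := by
  have hk : ∀ i, pd μ (fun q => 1 / 2 * pd i (MAG.profile H) q) p
      = 1 / 2 * pd μ (pd i (MAG.profile H)) p := fun i =>
    pd_const_mul _ (differentiableAt_of_smoothOn W.isOpen (contDiffOn_pd W.isOpen W.profile i) hp)
  have hn : pd μ (fun q => -MAG.amplitude A φ₀ q) p = -pd μ (MAG.amplitude A φ₀) p := pd_neg
  ext i j
  rw [pdM_apply]
  fin_cases ν <;> fin_cases i <;> fin_cases j <;>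
    first
    | exact pd_const 0
    | exact hk _
    | exact hn
    | rfl

theorem hessian_comm (hp : p ∈ U) (μ ν : Fin 4) :
    pd μ (pd ν (MAG.profile H)) p = pd ν (pd μ (MAG.profile H)) p :=
  pd_comm W.isOpen W.profile hp μ ν

/-- The curvature of the wave in the coordinate frame. -/
theorem matCurv_coordCon (hp : p ∈ U) (μ ν : Fin 4) :
    matCurv F.coordCon μ ν p =
      (if μ = 0 then waveCurv (fun i j => pd i (pd j (MAG.profile H)) p) (MAG.amplitude A φ₀ p)
        (pd 0 (MAG.amplitude A φ₀) p) ν else 0) -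
      (if ν = 0 then waveCurv (fun i j => pd i (pd j (MAG.profile H)) p) (MAG.amplitude A φ₀ p)
        (pd 0 (MAG.amplitude A φ₀) p) μ else 0) := by
  have hG : ∀ α β, pdM α (F.coordCon β) p
      = waveCon (fun i => pd α (pd i (MAG.profile H)) p) (pd α (MAG.amplitude A φ₀) p) β := by
    intro α β
    rw [pdM_congr_on W.isOpen hp fun q hq => W.coordCon_eq hq β, W.pdM_waveCon hp]
  rw [matCurv, hG, hG, W.coordCon_eq hp, W.coordCon_eq hp]
  refine waveCon_curvature _ (fun i j => pd i (pd j (MAG.profile H)) p) _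
    (fun i => pd i (MAG.amplitude A φ₀) p) (W.hessian_comm hp)
    (fun i => by simp [pd_profile_one]) (fun i hi => by simp [pd_amplitude _ _ hi]) μ ν

/-- The frame components `R_{μν}` as conjugates of the coordinate components. -/
theorem coordCurv_mul_cof (hp : p ∈ U) (μ ν : Fin 4) :
    matCurv F.coordCon μ ν p * F.cof p = F.cof p * matCurv F.conMat μ ν p :=
  matCurv_gauge W.isOpen W.smooth.cof (Fields.SmoothOn.coordCon W.isOpen W.smooth
    fun _ hq => W.det_cof hq) W.smooth.conMat (fun μ _ hq => Fields.pdM_cof (W.det_cof hq) μ) hp μ ν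

theorem matCurv_conMat (hp : p ∈ U) (μ ν : Fin 4) :
    matCurv F.conMat μ ν p = F.frame p * matCurv F.coordCon μ ν p * F.cof p := by
  rw [Matrix.mul_assoc, W.coordCurv_mul_cof hp, Fields.frame,
    Matrix.nonsing_inv_mul_cancel_left _ _ (W.det_cof hp).isUnit]

/-- Only the `(0,2)` entry of `R_{02}` and the `(0,3)` entry of `R_{03}` survive the contraction;
the derivative of the amplitude occurs in neither. -/
theorem contract_coordCurv (hp : p ∈ U) (μ σ : Fin 4) :
    ∑ ν, matCurv F.coordCon μ ν p σ ν = if μ = 0 ∧ σ = 0 then waveRicci H A φ₀ p else 0 := by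
  simp only [W.matCurv_coordCon hp, Matrix.sub_apply, Fin.sum_univ_four]
  fin_cases μ <;> fin_cases σ <;>
    simp [waveCurv, nullMat, waveRicci, transLaplacian_eq]
  ring

/-- `F.frame p a 0` is `du(e_a)`, so the Ricci tensor is a multiple of `du ⊗ du`. The contracted
frame index cancels against the dual one, which reduces the claim to `contract_coordCurv`. -/
theorem ricci_eq (hp : p ∈ U) (a b : Fin 4) :
    F.ricci p a b = waveRicci H A φ₀ p * (F.frame p a 0 * F.frame p b 0) := by
  have h1 : ∀ μ ν, ∑ c, F.frame p c ν * F.curvature p μ ν b c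
      = ∑ σ, F.frame p b σ * matCurv F.coordCon μ ν p σ ν := by
    intro μ ν
    have h2 : matCurv F.conMat μ ν p * F.frame p = F.frame p * matCurv F.coordCon μ ν p := by
      rw [W.matCurv_conMat hp, Fields.frame,
        Matrix.mul_nonsing_inv_cancel_right _ _ (W.det_cof hp).isUnit]
    rw [← Matrix.mul_apply, ← h2, Matrix.mul_apply]
    exact Finset.sum_congr rfl fun c _ => by rw [F.curvature_eq_matCurv, mul_comm]
  have h3 : F.ricci p a b = ∑ μ, F.frame p a μ * ∑ ν, ∑ c, F.frame p c ν * F.curvature p μ ν b c := by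
    rw [Fields.ricci, Finset.sum_comm]
    refine Finset.sum_congr rfl fun μ _ => ?_
    rw [Finset.sum_comm, Finset.mul_sum]
    refine Finset.sum_congr rfl fun ν _ => ?_
    rw [Finset.mul_sum]
    exact Finset.sum_congr rfl fun c _ => by ring
  have h4 : ∀ μ, ∑ ν, ∑ c, F.frame p c ν * F.curvature p μ ν b c
      = if μ = 0 then F.frame p b 0 * waveRicci H A φ₀ p else 0 := by
    intro μ
    simp only [h1]
    rw [Finset.sum_comm]
    simp only [← Finset.mul_sum, W.contract_coordCurv hp]
    by_cases hμ : μ = 0 <;> simp [hμ]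
  rw [h3]
  simp only [h4]
  simp
  ring

/-- `du` is parallel for `∇`, written in frame components `du(e_a)`. -/
theorem pd_frame (hp : p ∈ U) (μ a : Fin 4) :
    pd μ (fun q => F.frame q a 0) p = ∑ c, F.con p μ a c * F.frame p c 0 := by
  have hu : IsUnit (F.cof p).det := (W.det_cof hp).isUnit
  have h1 : pdM μ F.frame p = F.conMat μ p * F.frame p - F.frame p * F.coordCon μ p := by
    have := pdM_inv (μ := μ) W.isOpen W.smooth.cof (fun _ hq => W.det_cof hq) hp
    change pdM μ F.frame p = _ at this
    rw [this, Fields.pdM_cof (W.det_cof hp), Fields.frame, mul_sub, sub_mul,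
      Matrix.nonsing_inv_mul_cancel_left _ _ hu, ← Matrix.mul_assoc,
      Matrix.mul_nonsing_inv_cancel_right _ _ hu]
    abel
  have h2 := congrFun (congrFun h1 a) 0
  rw [pdM_apply, Matrix.sub_apply, Matrix.mul_apply (M := F.frame p)] at h2
  simp only [W.coordCon_eq hp, waveCon_col_zero, mul_zero, Finset.sum_const_zero, sub_zero] at h2
  rw [h2, Matrix.mul_apply]
  rfl

theorem christoffel_zero (hp : p ∈ U) (μ ν : Fin 4) : F.christoffel p μ ν 0 = 0 := by
  have h1 : pd 1 (MAG.profile H) p = 0 := by rw [pd_profile_one]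
  simp [Fields.christoffel, W.gInv_eq hp, Fin.sum_univ_four, ppMetricInv, W.pd_metric hp, h1]

theorem pd_frame_leviCivita (hp : p ∈ U) (μ a : Fin 4) :
    pd μ (fun q => F.frame q a 0) p = ∑ c, F.leviCivita p μ a c * F.frame p c 0 := by
  have h1 : Matrix.of (F.leviCivita p μ) =
      (Matrix.of fun a ρ => pd μ (fun q => F.frame q a ρ) p +
        ∑ ν, F.christoffel p μ ν ρ * F.frame p a ν) * F.cof p := by
    ext a b
    rw [Matrix.mul_apply]
    rfl
  have h2 : Matrix.of (F.leviCivita p μ) * F.frame p =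
      Matrix.of fun a ρ => pd μ (fun q => F.frame q a ρ) p +
        ∑ ν, F.christoffel p μ ν ρ * F.frame p a ν := by
    rw [h1]
    exact Matrix.mul_nonsing_inv_cancel_right _ _ (W.det_cof hp).isUnit
  have h3 := congrFun (congrFun h2 a) 0
  rw [Matrix.mul_apply] at h3
  simp only [Matrix.of_apply, W.christoffel_zero hp, zero_mul, Finset.sum_const_zero, add_zero]
    at h3
  exact h3.symm

theorem smooth_waveRicci : ContDiffOn ℝ ∞ (waveRicci H A φ₀) U := by
  have h2 := contDiffOn_pd W.isOpen (contDiffOn_pd W.isOpen W.profile 2) 2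
  have h3 := contDiffOn_pd W.isOpen (contDiffOn_pd W.isOpen W.profile 3) 3
  exact (contDiffOn_const.mul (h2.add h3)).add (contDiffOn_const.mul (W.amplitude.pow 2))

/-- Along any connection for which `du` is parallel, only the profile of the Ricci tensor is
differentiated. -/
theorem covDeriv_ricci (hp : p ∈ U) {Γ : Pt → Fin 4 → Fin 4 → Fin 4 → ℝ}
    (hΓ : ∀ μ a, pd μ (fun q => F.frame q a 0) p = ∑ c, Γ p μ a c * F.frame p c 0)
    (μ a b : Fin 4) :
    covDeriv Γ F.ricci p μ a b =
      pd μ (waveRicci H A φ₀) p * (F.frame p a 0 * F.frame p b 0) := by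
  have hf : DifferentiableAt ℝ (waveRicci H A φ₀) p :=
    differentiableAt_of_smoothOn W.isOpen W.smooth_waveRicci hp
  have he : ∀ a, DifferentiableAt ℝ (fun q => F.frame q a 0) p := fun a =>
    (W.smooth.cof.inv fun _ hq => W.det_cof hq).differentiableAt W.isOpen hp a 0
  rw [covDeriv, pd_congr_on W.isOpen hp fun q hq => W.ricci_eq hq a b,
    pd_mul hf ((he a).fun_mul (he b)), pd_mul (he a) (he b), hΓ, hΓ]
  simp only [W.ricci_eq hp, Finset.sum_add_distrib, Finset.sum_mul, Finset.mul_sum, mul_add]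
  have e1 : ∀ c, waveRicci H A φ₀ p * (Γ p μ a c * F.frame p c 0 * F.frame p b 0)
    = Γ p μ a c * (waveRicci H A φ₀ p * (F.frame p c 0 * F.frame p b 0)) := fun c => by ring
  have e2 : ∀ c, waveRicci H A φ₀ p * (F.frame p a 0 * (Γ p μ b c * F.frame p c 0))
    = Γ p μ b c * (waveRicci H A φ₀ p * (F.frame p a 0 * F.frame p c 0)) := fun c => by ring
  simp only [e1, e2]
  ring

theorem exists_frame_ne_zero (hp : p ∈ U) : ∃ a, F.frame p a 0 ≠ 0 := by
  by_contra! h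
  have h1 : (F.cof p * F.frame p) 0 0 = 1 := by
    rw [Fields.frame, Matrix.mul_nonsing_inv _ (W.det_cof hp).isUnit, Matrix.one_apply_eq]
  rw [Matrix.mul_apply] at h1
  simp [h] at h1

theorem pd_waveRicci_eq_zero
    (h : ∀ p ∈ U, ∀ μ a b, covDeriv F.con F.ricci p μ a b = 0) (hp : p ∈ U) (μ : Fin 4) :
    pd μ (waveRicci H A φ₀) p = 0 := by
  obtain ⟨a, ha⟩ := W.exists_frame_ne_zero hp
  have h1 := h p hp μ a a
  rw [W.covDeriv_ricci hp (W.pd_frame hp)] at h1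
  exact (mul_eq_zero.1 h1).resolve_right (mul_ne_zero ha ha)

theorem ricci_parallel_iff (hUc : IsPreconnected U) :
    (∀ p ∈ U, ∀ μ a b, covDeriv F.con F.ricci p μ a b = 0) ↔
      ∃ C : ℝ, ∀ p ∈ U, transLaplacian H p = (1 / 9) * A (p 0 + φ₀) ^ 2 + C := by
  constructor
  · intro h
    obtain ⟨C, hC⟩ := exists_const_of_pd_eq_zero W.isOpen hUc W.smooth_waveRicci
      fun p hp μ => W.pd_waveRicci_eq_zero h hp μ
    -- The constant value of `waveRicci` is `-½` times that of `ΔH - A²/9`.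
    refine ⟨-2 * C, fun p hp => ?_⟩
    have := hC p hp
    rw [waveRicci_eq] at this
    linarith
  · rintro ⟨C, hC⟩ p hp μ a b
    rw [W.covDeriv_ricci hp (W.pd_frame hp),
      pd_congr_on (g := fun _ => -(1 / 2) * C) W.isOpen hp fun q hq => by
        rw [waveRicci_eq, hC q hq]; ring]
    simp

end IsAxialWave

end

/-! ### Differentiation under the integral and integrals of divergences. -/

section Integration

/-- Differentiation under the integral sign over a compact set, for jointly smooth integrands. -/
theorem hasDerivAt_setIntegral_of_contDiffOn {Φ : ℝ × Pt → ℝ} {W : Set (ℝ × Pt)} (hW : IsOpen W)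
    (hΦ : ContDiffOn ℝ ∞ Φ W) {K : Set Pt} (hK : IsCompact K) (h0 : ∀ p ∈ K, ((0 : ℝ), p) ∈ W) :
    HasDerivAt (fun t : ℝ => ∫ p in K, Φ (t, p))
      (∫ p in K, fderiv ℝ Φ (0, p) ((1 : ℝ), (0 : Pt))) 0 := by
  -- The tube lemma yields a compact product `closedBall 0 ε ×ˢ K` inside `W`, on which the
  -- parameter derivative has a uniform bound.
  obtain ⟨u, v, hu, -, h0u, hKv, huv⟩ := generalized_tube_lemma (isCompact_singleton (x := (0 : ℝ)))
    hK hW (by rintro ⟨t, p⟩ ⟨ht, hp⟩; obtain rfl : t = 0 := ht; exact h0 p hp)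
  obtain ⟨ε, hε, hεu⟩ := Metric.nhds_basis_closedBall.mem_iff.1 (hu.mem_nhds (h0u rfl))
  have hsub : Metric.closedBall (0 : ℝ) ε ×ˢ K ⊆ W :=
    (Set.prod_mono hεu hKv).trans huv
  have hfd : ContinuousOn (fun x => fderiv ℝ Φ x ((1 : ℝ), (0 : Pt))) W :=
    ((hΦ.fderiv_of_isOpen (m := ∞) hW (by simp)).clm_apply contDiffOn_const).continuousOn
  obtain ⟨C, hC⟩ := ((isCompact_closedBall (0 : ℝ) ε).prod hK).exists_bound_of_continuousOn
    (hfd.mono hsub)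
  have hpair : ∀ t : ℝ, ContinuousOn (fun p : Pt => (t, p)) K := fun t => by fun_prop
  have hmaps : ∀ t ∈ Metric.closedBall (0 : ℝ) ε, Set.MapsTo (fun p : Pt => (t, p)) K W :=
    fun t ht p hp => hsub ⟨ht, hp⟩
  have h0b : (0 : ℝ) ∈ Metric.closedBall (0 : ℝ) ε := Metric.mem_closedBall_self hε.le
  refine (hasDerivAt_integral_of_dominated_loc_of_deriv_le (μ := volume.restrict K)
    (F := fun t p => Φ (t, p))
    (F' := fun t p => fderiv ℝ Φ (t, p) ((1 : ℝ), (0 : Pt))) (bound := fun _ => C)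
    (Metric.closedBall_mem_nhds (0 : ℝ) hε) ?_ ?_ ?_ ?_ ?_ ?_).2
  · filter_upwards [Metric.closedBall_mem_nhds (0 : ℝ) hε] with t ht
    exact (hΦ.continuousOn.comp (hpair t) (hmaps t ht)).aestronglyMeasurable_of_isCompact hK
      hK.measurableSet
  · exact (hΦ.continuousOn.comp (hpair 0) (hmaps 0 h0b)).integrableOn_compact hK
  · exact (hfd.comp (hpair 0) (hmaps 0 h0b)).aestronglyMeasurable_of_isCompact hK hK.measurableSet
  · exact (ae_restrict_iff' hK.measurableSet).2 (.of_forall fun p hp t ht => hC (t, p) ⟨ht, hp⟩)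
  · exact integrableOn_const hK.measure_ne_top
  · refine (ae_restrict_iff' hK.measurableSet).2 (.of_forall fun p hp t ht => ?_)
    have hd : DifferentiableAt ℝ Φ (t, p) :=
      (hΦ.contDiffAt (hW.mem_nhds (hsub ⟨ht, hp⟩))).differentiableAt (by simp)
    exact hd.hasFDerivAt.comp_hasDerivAt t ((hasDerivAt_id t).prodMk (hasDerivAt_const t p))

variable {U K : Set Pt} {V : Pt → ℝ}

/-- `U` and the complement of `K` are open and cover the chart, and `V` vanishes on the latter. -/
theorem contDiff_of_smoothOn_of_support (hU : IsOpen U) (hK : IsCompact K) (hKU : K ⊆ U)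
    (hV : ContDiffOn ℝ ∞ V U) (h0 : ∀ p, p ∉ K → V p = 0) : ContDiff ℝ ∞ V := by
  rw [contDiff_iff_contDiffAt]
  intro p
  by_cases hp : p ∈ K
  · exact hV.contDiffAt (hU.mem_nhds (hKU hp))
  · exact (contDiffAt_const (c := (0 : ℝ))).congr_of_eventuallyEq
      (Filter.eventually_of_mem (hK.isClosed.isOpen_compl.mem_nhds hp) h0)

theorem integrableOn_pd (hU : IsOpen U) (hK : IsCompact K) (hKU : K ⊆ U)
    (hV : ContDiffOn ℝ ∞ V U) (μ : Fin 4) : IntegrableOn (pd μ V) K :=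
  ((contDiffOn_pd hU hV μ).continuousOn.mono hKU).integrableOn_compact hK

/-- The integral of a partial derivative of a compactly supported function vanishes. -/
theorem setIntegral_pd_eq_zero (hU : IsOpen U) (hK : IsCompact K) (hKU : K ⊆ U)
    (hV : ContDiffOn ℝ ∞ V U) (h0 : ∀ p, p ∉ K → V p = 0) (μ : Fin 4) :
    ∫ p in K, pd μ V p = 0 := by
  have hs := contDiff_of_smoothOn_of_support hU hK hKU hV h0
  have hpd0 : ∀ p, p ∉ K → pd μ V p = 0 := fun p hp => by
    rw [pd_congr (g := fun _ => 0)
      (Filter.eventually_of_mem (hK.isClosed.isOpen_compl.mem_nhds hp) h0), pd_const]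
  rw [setIntegral_eq_integral_of_forall_compl_eq_zero hpd0]
  have hc : Continuous (pd μ V) :=
    (hs.continuous_fderiv (by simp)).clm_apply continuous_const
  have hi : Integrable (pd μ V) := hc.integrable_of_hasCompactSupport (.intro hK hpd0)
  have hiV : Integrable V := hs.continuous.integrable_of_hasCompactSupport (.intro hK h0)
  -- Integration by parts against the constant function `1`.
  have := integral_mul_fderiv_eq_neg_fderiv_mul_of_integrable (μ := (volume : Measure Pt))
    (f := fun _ => (1 : ℝ)) (g := V) (v := Pi.single μ 1) (by simp) (by simp only [one_mul]; exact hi)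
    (by simpa using hiV) (fun _ _ => differentiableAt_const _)
    (fun x _ => hs.differentiable (by simp) x)
  simpa [pd] using this

end Integration

/-! ### The Lagrangian as a sum of traces. -/

section Lagrangian

theorem sum_eps_mul_eps (μ ν α β : Fin 4) :
    ∑ σ, ∑ τ, (eps μ ν σ τ : ℝ) * (eps α β σ τ : ℝ) =
      2 * ((if μ = α ∧ ν = β then 1 else 0) - (if μ = β ∧ ν = α then 1 else 0)) := by
  -- Over the integers the contraction identity is a finite decidable check.
  have h : ∀ μ ν α β : Fin 4, ∑ σ, ∑ τ, eps μ ν σ τ * eps α β σ τ =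
      2 * ((if μ = α ∧ ν = β then 1 else 0) - (if μ = β ∧ ν = α then 1 else 0)) := by
    decide +kernel
  exact_mod_cast h μ ν α β

/-- The contraction `X ∧ ⋆Y` of 2-forms with components `X` and `Y`. -/
theorem sum_eps_star2 (F : Fields) (p : Pt) (X Y : Fin 4 → Fin 4 → ℝ)
    (hX : ∀ μ ν, X μ ν = -X ν μ) :
    ∑ μ, ∑ ν, ∑ σ, ∑ τ, (eps μ ν σ τ : ℝ) * X μ ν * F.star2 p Y σ τ =
      2 * Real.sqrt |(F.g p).det| *
        ∑ μ, ∑ ν, ∑ τ, ∑ κ, F.gInv p μ τ * F.gInv p ν κ * (X μ ν * Y τ κ) := by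
  set Z : Fin 4 → Fin 4 → ℝ := fun μ ν => ∑ τ, ∑ κ, F.gInv p μ τ * F.gInv p ν κ * Y τ κ with hZ
  set r := Real.sqrt |(F.g p).det| with hr
  have h1 : ∀ σ τ, F.star2 p Y σ τ = ∑ α, ∑ β, (1 / 2) * r * Z α β * (eps α β σ τ : ℝ) := by
    intro σ τ
    simp only [Fields.star2, Fields.vol, hZ, Finset.mul_sum, Finset.sum_mul]
    refine Finset.sum_congr rfl fun α _ => Finset.sum_congr rfl fun β _ =>
      Finset.sum_congr rfl fun _ _ => Finset.sum_congr rfl fun _ _ => ?_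
    ring
  have h2 : ∀ μ ν, ∑ σ, ∑ τ, (eps μ ν σ τ : ℝ) * X μ ν * F.star2 p Y σ τ
      = r * (X μ ν * Z μ ν - X μ ν * Z ν μ) := by
    intro μ ν
    have h3 : ∑ σ, ∑ τ, (eps μ ν σ τ : ℝ) * X μ ν * F.star2 p Y σ τ
        = ∑ α, ∑ β, (1 / 2) * r * X μ ν * Z α β *
          ∑ σ, ∑ τ, (eps μ ν σ τ : ℝ) * (eps α β σ τ : ℝ) := by
      simp only [h1, Finset.mul_sum]
      calc _ = ∑ σ, ∑ α, ∑ τ, ∑ β, (eps μ ν σ τ : ℝ) * X μ ν *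
              ((1 / 2) * r * Z α β * (eps α β σ τ : ℝ)) :=
            Finset.sum_congr rfl fun σ _ => Finset.sum_comm
        _ = ∑ α, ∑ σ, ∑ τ, ∑ β, (eps μ ν σ τ : ℝ) * X μ ν *
              ((1 / 2) * r * Z α β * (eps α β σ τ : ℝ)) := Finset.sum_comm
        _ = ∑ α, ∑ σ, ∑ β, ∑ τ, (eps μ ν σ τ : ℝ) * X μ ν *
              ((1 / 2) * r * Z α β * (eps α β σ τ : ℝ)) :=
            Finset.sum_congr rfl fun α _ => Finset.sum_congr rfl fun σ _ => Finset.sum_comm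
        _ = ∑ α, ∑ β, ∑ σ, ∑ τ, (eps μ ν σ τ : ℝ) * X μ ν *
              ((1 / 2) * r * Z α β * (eps α β σ τ : ℝ)) :=
            Finset.sum_congr rfl fun α _ => Finset.sum_comm
        _ = _ := by
            refine Finset.sum_congr rfl fun α _ => Finset.sum_congr rfl fun β _ =>
              Finset.sum_congr rfl fun _ _ => Finset.sum_congr rfl fun _ _ => ?_
            ring
    rw [h3]
    simp only [sum_eps_mul_eps, mul_sub, Finset.sum_sub_distrib, ite_and]
    simp
    ring
  simp only [h2, ← Finset.mul_sum, Finset.sum_sub_distrib]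
  have h4 : ∑ μ, ∑ ν, X μ ν * Z ν μ = -∑ μ, ∑ ν, X μ ν * Z μ ν := by
    rw [Finset.sum_comm, ← Finset.sum_neg_distrib]
    refine Finset.sum_congr rfl fun ν _ => ?_
    rw [← Finset.sum_neg_distrib]
    refine Finset.sum_congr rfl fun μ _ => ?_
    rw [hX μ ν]; ring
  have h5 : ∑ μ, ∑ ν, ∑ τ, ∑ κ, F.gInv p μ τ * F.gInv p ν κ * (X μ ν * Y τ κ)
      = ∑ μ, ∑ ν, X μ ν * Z μ ν := by
    simp only [hZ, Finset.mul_sum]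
    refine Finset.sum_congr rfl fun α _ => Finset.sum_congr rfl fun β _ =>
      Finset.sum_congr rfl fun _ _ => Finset.sum_congr rfl fun _ _ => ?_
    ring
  rw [h4, h5]
  ring

/-- The Lagrangian in terms of traces of products of curvature matrices. -/
theorem ymLagrangian_eq (ρ : ℝ) (F : Fields) (p : Pt) :
    F.ymLagrangian ρ p = ∑ μ, ∑ ν, ∑ τ, ∑ κ,
      -(1 / (4 * ρ)) * (Real.sqrt |(F.g p).det| * F.gInv p μ τ * F.gInv p ν κ) *
        (matCurv F.conMat μ ν p * matCurv F.conMat τ κ p).trace := by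
  have hanti : ∀ a b μ ν, F.curvature p μ ν a b = -F.curvature p ν μ a b := by
    intro a b μ ν
    rw [F.curvature_eq_matCurv, matCurv_antisymm, Matrix.neg_apply, F.curvature_eq_matCurv]
  have h1 : ∀ a b, ∑ μ, ∑ ν, ∑ σ, ∑ τ, (eps μ ν σ τ : ℝ) *
      F.curvature p μ ν a b * F.star2 p (fun κ l => F.curvature p κ l b a) σ τ = _ := fun a b =>
    sum_eps_star2 F p (fun μ ν => F.curvature p μ ν a b) (fun μ ν => F.curvature p μ ν b a)
      (hanti a b)
  have h2 : F.ymLagrangian ρ p = ∑ a, ∑ b, ∑ μ, ∑ ν, ∑ τ, ∑ κ,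
      -(1 / (4 * ρ)) * (Real.sqrt |(F.g p).det| * F.gInv p μ τ * F.gInv p ν κ) *
        (F.curvature p μ ν a b * F.curvature p τ κ b a) := by
    simp only [Fields.ymLagrangian, h1, Finset.mul_sum]
    refine Finset.sum_congr rfl fun a _ => Finset.sum_congr rfl fun b _ =>
      Finset.sum_congr rfl fun α _ => Finset.sum_congr rfl fun β _ =>
      Finset.sum_congr rfl fun _ _ => Finset.sum_congr rfl fun _ _ => ?_
    -- The `1/2` is the `1/4` in the definition times the `2` from `sum_eps_star2`.
    have h4 : 1 / (4 * ρ) = 1 / (2 * ρ) * (1 / 2) := by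
      rw [one_div_mul_one_div]; congr 1; ring
    rw [h4]
    ring
  rw [h2]
  have sw : ∀ f : Fin 4 → Fin 4 → Fin 4 → ℝ,
      ∑ a, ∑ b, ∑ μ, f a b μ = ∑ μ, ∑ a, ∑ b, f a b μ := fun f => by
    rw [Finset.sum_congr rfl fun a _ => Finset.sum_comm, Finset.sum_comm]
  rw [sw]
  refine Finset.sum_congr rfl fun μ _ => ?_
  rw [sw]
  refine Finset.sum_congr rfl fun ν _ => ?_
  rw [sw]
  refine Finset.sum_congr rfl fun τ _ => ?_
  rw [sw]
  refine Finset.sum_congr rfl fun κ _ => ?_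
  simp only [← Finset.mul_sum, Matrix.trace, Matrix.diag, Matrix.mul_apply,
    F.curvature_eq_matCurv]

end Lagrangian

/-! ### First variation of the action. -/

noncomputable section

theorem SmoothMat.comp_snd {M : Pt → Matrix (Fin 4) (Fin 4) ℝ} {U : Set Pt} (hM : SmoothMat M U)
    {W : Set (ℝ × Pt)} (hW : ∀ x ∈ W, x.2 ∈ U) : SmoothMat (fun x : ℝ × Pt => M x.2) W :=
  fun i j => (hM i j).comp contDiffOn_snd hW

theorem SmoothMat.smul {E : Type*} [NormedAddCommGroup E] [NormedSpace ℝ E] {f : E → ℝ}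
    {M : E → Matrix (Fin 4) (Fin 4) ℝ} {s : Set E} (hf : ContDiffOn ℝ ∞ f s)
    (hM : SmoothMat M s) : SmoothMat (fun x => f x • M x) s :=
  fun i j => hf.mul (hM i j)

theorem SmoothMat.mono {E : Type*} [NormedAddCommGroup E] [NormedSpace ℝ E]
    {M : E → Matrix (Fin 4) (Fin 4) ℝ} {s t : Set E} (hM : SmoothMat M s) (h : t ⊆ s) :
    SmoothMat M t :=
  fun i j => (hM i j).mono h

theorem SmoothMat.matCurv {U : Set Pt} (hU : IsOpen U)
    {G : Fin 4 → Pt → Matrix (Fin 4) (Fin 4) ℝ} (hG : ∀ μ, SmoothMat (G μ) U) (μ ν : Fin 4) :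
    SmoothMat (matCurv G μ ν) U :=
  (((hG ν).pdM hU μ).sub ((hG μ).pdM hU ν)).add (((hG ν).mul (hG μ)).sub ((hG μ).mul (hG ν)))

/-- The linearization of the curvature `R_{μν}` at the connection `G` in the direction `D`. -/
def curvVar (G D : Fin 4 → Pt → Matrix (Fin 4) (Fin 4) ℝ) (μ ν : Fin 4) (p : Pt) :
    Matrix (Fin 4) (Fin 4) ℝ :=
  pdM μ (D ν) p - pdM ν (D μ) p +
    (D ν p * G μ p + G ν p * D μ p - (D μ p * G ν p + G μ p * D ν p))

theorem curvVar_antisymm (G D : Fin 4 → Pt → Matrix (Fin 4) (Fin 4) ℝ) (μ ν : Fin 4) (p : Pt) :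
    curvVar G D μ ν p = -curvVar G D ν μ p := by
  unfold curvVar; abel

/-- Curvature is quadratic in the connection, so the expansion stops at `t ^ 2`. -/
theorem matCurv_add_smul {U : Set Pt} (hU : IsOpen U)
    {G D : Fin 4 → Pt → Matrix (Fin 4) (Fin 4) ℝ} (hG : ∀ μ, SmoothMat (G μ) U)
    (hD : ∀ μ, SmoothMat (D μ) U) {p : Pt} (hp : p ∈ U) (t : ℝ) (μ ν : Fin 4) :
    matCurv (fun α q => G α q + t • D α q) μ ν p = matCurv G μ ν p + t • curvVar G D μ ν p +
      t ^ 2 • (D ν p * D μ p - D μ p * D ν p) := by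
  have h : ∀ α β, pdM α (fun q => G β q + t • D β q) p = pdM α (G β) p + t • pdM α (D β) p := by
    intro α β
    ext i j
    have hd := (hD β).differentiableAt hU hp i j
    simp only [pdM_apply, Matrix.add_apply, Matrix.smul_apply, smul_eq_mul]
    rw [pd_add ((hG β).differentiableAt hU hp i j) (hd.const_mul t), pd_const_mul t hd]
  simp only [matCurv, curvVar, h, add_mul, mul_add, smul_mul_assoc, mul_smul_comm, smul_add,
    smul_sub, smul_smul, pow_two]
  abel

variable {F δ : Fields} {U K : Set Pt} {p : Pt}

namespace Fields

theorem vary_conMat (t : ℝ) :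
    (F.vary δ t).conMat = fun μ p => F.conMat μ p + t • δ.conMat μ p := rfl

/-- The pairs of a parameter and a point of `U` at which the varied metric is nondegenerate. -/
def varyDomain (F δ : Fields) (U : Set Pt) : Set (ℝ × Pt) :=
  {x | x.2 ∈ U ∧ ((F.vary δ x.1).g x.2).det ≠ 0}

theorem smoothMat_vary_g (hF : F.SmoothOn U) (hδ : δ.SmoothOn U) :
    SmoothMat (fun x : ℝ × Pt => (F.vary δ x.1).g x.2) (Prod.snd ⁻¹' U) := by
  have hs : ∀ x ∈ (Prod.snd ⁻¹' U : Set (ℝ × Pt)), x.2 ∈ U := fun _ h => h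
  have hc := (hF.cof.comp_snd hs).add (.smul contDiffOn_fst (hδ.cof.comp_snd hs))
  have hm := (hF.met.comp_snd hs).add (.smul contDiffOn_fst (hδ.met.comp_snd hs))
  exact (hc.mul hm).mul hc.transpose

theorem isOpen_varyDomain (hU : IsOpen U) (hF : F.SmoothOn U) (hδ : δ.SmoothOn U) :
    IsOpen (varyDomain F δ U) :=
  (smoothMat_vary_g hF hδ).det.continuousOn.isOpen_inter_preimage (hU.preimage continuous_snd)
    isOpen_ne

/-- Joint smoothness in `(t, p)` comes from the expansion in `t`: the curvature is a polynomial in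
`t` whose coefficients are smooth on `U`. -/
theorem smoothMat_vary_matCurv (hU : IsOpen U) (hF : F.SmoothOn U) (hδ : δ.SmoothOn U)
    (μ ν : Fin 4) :
    SmoothMat (fun x : ℝ × Pt => matCurv (F.vary δ x.1).conMat μ ν x.2) (Prod.snd ⁻¹' U) := by
  have hs : ∀ x ∈ (Prod.snd ⁻¹' U : Set (ℝ × Pt)), x.2 ∈ U := fun _ h => h
  have h1 : SmoothMat (curvVar F.conMat δ.conMat μ ν) U :=
    (((hδ.conMat ν).pdM hU μ).sub ((hδ.conMat μ).pdM hU ν)).add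
      ((((hδ.conMat ν).mul (hF.conMat μ)).add ((hF.conMat ν).mul (hδ.conMat μ))).sub
        (((hδ.conMat μ).mul (hF.conMat ν)).add ((hF.conMat μ).mul (hδ.conMat ν))))
  have h2 := ((hδ.conMat ν).mul (hδ.conMat μ)).sub ((hδ.conMat μ).mul (hδ.conMat ν))
  refine ((((SmoothMat.matCurv hU hF.conMat μ ν).comp_snd hs).add
    (.smul contDiffOn_fst (h1.comp_snd hs))).add
      (.smul (contDiffOn_fst.pow 2) (h2.comp_snd hs))).congr fun x hx => ?_
  rw [vary_conMat, matCurv_add_smul hU hF.conMat hδ.conMat hx]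

theorem smooth_vary_weight (hF : F.SmoothOn U) (hδ : δ.SmoothOn U) (μ ν τ κ : Fin 4) :
    ContDiffOn ℝ ∞ (fun x : ℝ × Pt => Real.sqrt |((F.vary δ x.1).g x.2).det| *
      (F.vary δ x.1).gInv x.2 μ τ * (F.vary δ x.1).gInv x.2 ν κ) (varyDomain F δ U) := by
  have hg := (smoothMat_vary_g hF hδ).mono (t := varyDomain F δ U) fun x hx => hx.1
  have hi := hg.inv fun x hx => hx.2
  have hr : ContDiffOn ℝ ∞ (fun x : ℝ × Pt => Real.sqrt |((F.vary δ x.1).g x.2).det|)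
      (varyDomain F δ U) :=
    (hg.det.abs fun x hx => hx.2).sqrt fun x hx => abs_ne_zero.2 hx.2
  exact (hr.mul (hi μ τ)).mul (hi ν κ)

theorem smooth_vary_ymLagrangian (hU : IsOpen U) (hF : F.SmoothOn U) (hδ : δ.SmoothOn U) (ρ : ℝ) :
    ContDiffOn ℝ ∞ (fun x : ℝ × Pt => ymLagrangian ρ (F.vary δ x.1) x.2) (varyDomain F δ U) := by
  simp only [ymLagrangian_eq]
  refine ContDiffOn.sum fun μ _ => ContDiffOn.sum fun ν _ => ContDiffOn.sum fun τ _ =>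
    ContDiffOn.sum fun κ _ => ?_
  have hs : varyDomain F δ U ⊆ Prod.snd ⁻¹' U := fun x hx => hx.1
  exact (contDiffOn_const.mul (smooth_vary_weight hF hδ μ ν τ κ)).mul
    (((smoothMat_vary_matCurv hU hF hδ μ ν).mono hs).trace_mul
      ((smoothMat_vary_matCurv hU hF hδ τ κ).mono hs))

theorem hasDerivAt_trace_mul (A₀ A₁ A₂ B₀ B₁ B₂ : Matrix (Fin 4) (Fin 4) ℝ) :
    HasDerivAt (fun t : ℝ => ((A₀ + t • A₁ + t ^ 2 • A₂) * (B₀ + t • B₁ + t ^ 2 • B₂)).trace)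
      ((A₀ * B₁).trace + (A₁ * B₀).trace) 0 := by
  have h : ∀ A₀ A₁ A₂ : Matrix (Fin 4) (Fin 4) ℝ, ∀ i j,
      HasDerivAt (fun t : ℝ => (A₀ + t • A₁ + t ^ 2 • A₂) i j) (A₁ i j) 0 := by
    intro A₀ A₁ A₂ i j
    simp only [Matrix.add_apply, Matrix.smul_apply, smul_eq_mul]
    have h1 := (((hasDerivAt_id (0 : ℝ)).mul_const (A₁ i j)).const_add (A₀ i j)).fun_add
      ((hasDerivAt_pow 2 (0 : ℝ)).mul_const (A₂ i j))
    simpa using h1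
  simp only [Matrix.trace, Matrix.diag, Matrix.mul_apply]
  rw [← Finset.sum_add_distrib]
  refine HasDerivAt.fun_sum fun i _ => ?_
  rw [← Finset.sum_add_distrib]
  refine HasDerivAt.fun_sum fun k _ => ?_
  have := (h A₀ A₁ A₂ i k).fun_mul (h B₀ B₁ B₂ k i)
  simpa [add_comm] using this

/-- If all traces of products of curvature matrices vanish at `p`, only the variation of the
connection contributes to the first variation of the Lagrangian there. -/
theorem fderiv_vary_ymLagrangian (hU : IsOpen U) (hF : F.SmoothOn U) (hδ : δ.SmoothOn U) (ρ : ℝ)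
    (hp : p ∈ U) (hdet : (F.g p).det ≠ 0)
    (htr : ∀ μ ν τ κ, (matCurv F.conMat μ ν p * matCurv F.conMat τ κ p).trace = 0) :
    fderiv ℝ (fun x : ℝ × Pt => ymLagrangian ρ (F.vary δ x.1) x.2) (0, p) (1, 0) =
      ∑ μ, ∑ ν, ∑ τ, ∑ κ,
        -(1 / (4 * ρ)) * (Real.sqrt |(F.g p).det| * F.gInv p μ τ * F.gInv p ν κ) *
        ((matCurv F.conMat μ ν p * curvVar F.conMat δ.conMat τ κ p).trace +
          (curvVar F.conMat δ.conMat μ ν p * matCurv F.conMat τ κ p).trace) := by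
  have hv0 : F.vary δ 0 = F := by
    obtain ⟨m, c, k⟩ := F
    simp [vary]
  have h0 : ((0 : ℝ), p) ∈ varyDomain F δ U := ⟨hp, by
    change ((F.vary δ 0).g p).det ≠ 0
    rwa [hv0]⟩
  have hW := (isOpen_varyDomain hU hF hδ).mem_nhds h0
  have hline : HasDerivAt (fun t : ℝ => (t, p)) ((1 : ℝ), (0 : Pt)) 0 :=
    (hasDerivAt_id (0 : ℝ)).prodMk (hasDerivAt_const (0 : ℝ) p)
  have hd : ∀ {Φ : ℝ × Pt → ℝ}, ContDiffOn ℝ ∞ Φ (varyDomain F δ U) →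
      HasDerivAt (fun t : ℝ => Φ (t, p)) (fderiv ℝ Φ (0, p) (1, 0)) 0 := fun h =>
    ((h.contDiffAt hW).differentiableAt (by simp)).hasFDerivAt.comp_hasDerivAt (0 : ℝ) hline
  refine (hd (smooth_vary_ymLagrangian hU hF hδ ρ)).unique ?_
  simp only [ymLagrangian_eq]
  refine HasDerivAt.fun_sum fun μ _ => HasDerivAt.fun_sum fun ν _ => HasDerivAt.fun_sum fun τ _ =>
    HasDerivAt.fun_sum fun κ _ => ?_
  have h1 := (hd (smooth_vary_weight hF hδ μ ν τ κ)).const_mul (-(1 / (4 * ρ)))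
  have h2 := hasDerivAt_trace_mul (matCurv F.conMat μ ν p) (curvVar F.conMat δ.conMat μ ν p)
    (δ.conMat ν p * δ.conMat μ p - δ.conMat μ p * δ.conMat ν p) (matCurv F.conMat τ κ p)
    (curvVar F.conMat δ.conMat τ κ p) (δ.conMat κ p * δ.conMat τ p - δ.conMat τ p * δ.conMat κ p)
  simp only [← matCurv_add_smul hU hF.conMat hδ.conMat hp] at h2
  have h3 := h1.fun_mul h2
  -- In the product rule the unknown derivative of the weight is multiplied by a trace that vanishes
  -- at `t = 0`.
  simp only [zero_smul, add_zero, htr, mul_zero, zero_add, hv0] at h3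
  exact h3

end Fields

theorem pd_pd_eq_zero {U : Set Pt} (hU : IsOpen U) {f : Pt → ℝ} (hf : ContDiffOn ℝ ∞ f U)
    {μ : Fin 4} (h : ∀ q ∈ U, pd μ f q = 0) (ν : Fin 4) {p : Pt} (hp : p ∈ U) :
    pd μ (pd ν f) p = 0 := by
  rw [pd_comm hU hf hp, pd_congr_on hU hp h, pd_const]

theorem nullMat_add (s w s' w' : ℝ) : nullMat s w + nullMat s' w' = nullMat (s + s') (w + w') := by
  ext i j
  fin_cases i <;> fin_cases j <;> simp [nullMat]

theorem nullMat_zero : nullMat 0 0 = 0 := by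
  ext i j; fin_cases i <;> fin_cases j <;> rfl

theorem pdM_nullMat (s w : Pt → ℝ) (μ : Fin 4) (p : Pt) :
    pdM μ (fun q => nullMat (s q) (w q)) p = nullMat (pd μ s p) (pd μ w p) := by
  ext i j
  rw [pdM_apply]
  fin_cases i <;> fin_cases j <;> first | exact pd_const 0 | rfl

/-! ### Field equations of the wave. -/

namespace IsAxialWave

variable {F : Fields} {U : Set Pt} {H : ℝ × ℝ × ℝ → ℝ} {A : ℝ → ℝ} {φ₀ : ℝ}
variable (W : IsAxialWave F U H A φ₀) {p : Pt}
include W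

theorem coordCurv_zero_eq (hp : p ∈ U) (i : Fin 4) :
    matCurv F.coordCon 0 i p = waveCurv (fun i j => pd i (pd j (MAG.profile H)) p)
      (MAG.amplitude A φ₀ p) (pd 0 (MAG.amplitude A φ₀) p) i := by
  rw [W.matCurv_coordCon hp]
  simp [waveCurv]

theorem frameCurv_eq (hp : p ∈ U) (μ ν : Fin 4) :
    matCurv F.conMat μ ν p = (if μ = 0 then matCurv F.conMat 0 ν p else 0) -
      (if ν = 0 then matCurv F.conMat 0 μ p else 0) := by
  simp only [W.matCurv_conMat hp]
  rw [W.matCurv_coordCon hp μ ν]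
  simp only [← W.coordCurv_zero_eq hp]
  split_ifs <;> simp [mul_sub, sub_mul]

theorem frameCurv_zero_one (hp : p ∈ U) : matCurv F.conMat 0 1 p = 0 := by
  rw [W.matCurv_conMat hp, W.coordCurv_zero_eq hp]
  simp [waveCurv]

theorem trace_frameCurv_mul (hp : p ∈ U) (μ ν τ κ : Fin 4) :
    (matCurv F.conMat μ ν p * matCurv F.conMat τ κ p).trace = 0 := by
  have h : ∀ i j, (matCurv F.conMat 0 i p * matCurv F.conMat 0 j p).trace = 0 := by
    intro i j
    obtain ⟨s, w, h1⟩ := exists_waveCurv_eq_nullMat (fun i j => pd i (pd j (MAG.profile H)) p)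
      (MAG.amplitude A φ₀ p) (pd 0 (MAG.amplitude A φ₀) p) i
    obtain ⟨s', w', h2⟩ := exists_waveCurv_eq_nullMat (fun i j => pd i (pd j (MAG.profile H)) p)
      (MAG.amplitude A φ₀ p) (pd 0 (MAG.amplitude A φ₀) p) j
    rw [← W.coordCurv_zero_eq hp] at h1 h2
    have h3 : matCurv F.conMat 0 i p * matCurv F.conMat 0 j p
        = F.frame p * (matCurv F.coordCon 0 i p * matCurv F.coordCon 0 j p) * F.cof p := by
      rw [W.matCurv_conMat hp 0 i, W.matCurv_conMat hp 0 j]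
      simp only [Matrix.mul_assoc, Fields.frame]
      rw [Matrix.mul_nonsing_inv_cancel_left _ _ (W.det_cof hp).isUnit]
    rw [h3, Matrix.trace_mul_comm, Fields.frame,
      Matrix.mul_nonsing_inv_cancel_left _ _ (W.det_cof hp).isUnit, h1, h2, trace_nullMat_mul]
  rw [W.frameCurv_eq hp μ ν, W.frameCurv_eq hp τ κ]
  split_ifs <;> simp [mul_sub, sub_mul, h]

theorem smooth_coordCon (μ : Fin 4) : SmoothMat (F.coordCon μ) U :=
  Fields.SmoothOn.coordCon W.isOpen W.smooth (fun _ hq => W.det_cof hq) μ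

/-- In general the last term would contain the coordinate covariant derivative; for `μ ≠ 0` its
commutator vanishes by `waveCon_comm_nullMat`. -/
theorem pdM_frameCurv (hp : p ∈ U) {μ : Fin 4} (hμ : μ ≠ 0) (i : Fin 4) :
    pdM μ (matCurv F.conMat 0 i) p = F.conMat μ p * matCurv F.conMat 0 i p -
      matCurv F.conMat 0 i p * F.conMat μ p +
      F.frame p * pdM μ (matCurv F.coordCon 0 i) p * F.cof p := by
  rw [pdM_conj W.isOpen W.smooth.cof (SmoothMat.matCurv W.isOpen W.smooth_coordCon 0 i)
    (SmoothMat.matCurv W.isOpen W.smooth.conMat 0 i) (fun _ hq => W.det_cof hq)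
    (fun μ _ hq => Fields.pdM_cof (W.det_cof hq) μ) (fun _ hq => W.coordCurv_mul_cof hq 0 i) hp]
  obtain ⟨s, w, h1⟩ := exists_waveCurv_eq_nullMat (fun i j => pd i (pd j (MAG.profile H)) p)
    (MAG.amplitude A φ₀ p) (pd 0 (MAG.amplitude A φ₀) p) i
  rw [← W.coordCurv_zero_eq hp] at h1
  rw [h1, W.coordCon_eq hp, waveCon_comm_nullMat _ _ _ _ hμ, sub_add_cancel]
  rfl

theorem pd_waveCurv_entry (hp : p ∈ U) {μ : Fin 4} (hμ : μ ≠ 0) (i j : Fin 4) :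
    pd μ (fun q => -(1 / 2) * pd i (pd j (MAG.profile H)) q + MAG.amplitude A φ₀ q ^ 2) p =
        -(1 / 2) * pd μ (pd i (pd j (MAG.profile H))) p ∧
      pd μ (fun q => -(1 / 2) * pd i (pd j (MAG.profile H)) q + pd 0 (MAG.amplitude A φ₀) q) p =
        -(1 / 2) * pd μ (pd i (pd j (MAG.profile H))) p ∧
      pd μ (fun q => -(1 / 2) * pd i (pd j (MAG.profile H)) q - pd 0 (MAG.amplitude A φ₀) q) p =
        -(1 / 2) * pd μ (pd i (pd j (MAG.profile H))) p := by
  have hh : DifferentiableAt ℝ (pd i (pd j (MAG.profile H))) p :=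
    differentiableAt_of_smoothOn W.isOpen
      (contDiffOn_pd W.isOpen (contDiffOn_pd W.isOpen W.profile j) i) hp
  have ha : DifferentiableAt ℝ (fun q => MAG.amplitude A φ₀ q ^ 2) p :=
    (differentiableAt_of_smoothOn W.isOpen W.amplitude hp).fun_pow 2
  have hb : DifferentiableAt ℝ (pd 0 (MAG.amplitude A φ₀)) p :=
    differentiableAt_of_smoothOn W.isOpen (contDiffOn_pd W.isOpen W.amplitude 0) hp
  have ha0 : pd μ (fun q => MAG.amplitude A φ₀ q ^ 2) p = 0 :=
    pd_eq_zero_of_update fun q s => by simp [MAG.amplitude, hμ.symm]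
  have hb0 : pd μ (pd 0 (MAG.amplitude A φ₀)) p = 0 :=
    pd_pd_eq_zero W.isOpen W.amplitude (fun q _ => by rw [pd_amplitude _ _ hμ]) 0 hp
  refine ⟨?_, ?_, ?_⟩
  · rw [pd_add (hh.const_mul _) ha, pd_const_mul _ hh, ha0, add_zero]
  · rw [pd_add (hh.const_mul _) hb, pd_const_mul _ hh, hb0, add_zero]
  · rw [pd_sub (hh.const_mul _) hb, pd_const_mul _ hh, hb0, sub_zero]

theorem pdM_coordCurv (hp : p ∈ U) {μ : Fin 4} (hμ : μ ≠ 0) :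
    pdM μ (matCurv F.coordCon 0 2) p =
        nullMat (-(1 / 2) * pd μ (pd 2 (pd 2 (MAG.profile H))) p)
          (-(1 / 2) * pd μ (pd 2 (pd 3 (MAG.profile H))) p) ∧
      pdM μ (matCurv F.coordCon 0 3) p =
        nullMat (-(1 / 2) * pd μ (pd 2 (pd 3 (MAG.profile H))) p)
          (-(1 / 2) * pd μ (pd 3 (pd 3 (MAG.profile H))) p) := by
  have e := W.pd_waveCurv_entry hp hμ
  constructor
  · rw [pdM_congr_on W.isOpen hp fun q hq => W.coordCurv_zero_eq hq 2]
    refine (pdM_nullMat _ _ μ p).trans ?_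
    rw [(e 2 2).1, (e 2 3).2.2]
  · rw [pdM_congr_on W.isOpen hp fun q hq => W.coordCurv_zero_eq hq 3]
    refine (pdM_nullMat _ _ μ p).trans ?_
    rw [(e 2 3).2.1, (e 3 3).1]

theorem pdM_one_coordCurv (hp : p ∈ U) :
    pdM 1 (matCurv F.coordCon 0 2) p = 0 ∧ pdM 1 (matCurv F.coordCon 0 3) p = 0 := by
  have h : ∀ i j, pd 1 (pd i (pd j (MAG.profile H))) p = 0 := fun i j =>
    pd_pd_eq_zero W.isOpen (contDiffOn_pd W.isOpen W.profile j)
      (fun q hq => pd_pd_eq_zero W.isOpen W.profile (fun q _ => by rw [pd_profile_one]) j hq) i hp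
  obtain ⟨h2, h3⟩ := W.pdM_coordCurv hp (μ := 1) (by decide)
  rw [h2, h3]
  simp [h, nullMat_zero]

/-- By symmetry of third derivatives the two entries are `-½ ∂_x ΔH` and `-½ ∂_y ΔH`. The amplitude
depends only on `u`, so `hR` makes both vanish. -/
theorem div_coordCurv (hR : ∀ μ, pd μ (waveRicci H A φ₀) p = 0) (hp : p ∈ U) :
    pdM 2 (matCurv F.coordCon 0 2) p + pdM 3 (matCurv F.coordCon 0 3) p = 0 := by
  have hs : ∀ i, ContDiffOn ℝ ∞ (pd i (MAG.profile H)) U := fun i =>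
    contDiffOn_pd W.isOpen W.profile i
  have hs2 : ∀ i j, DifferentiableAt ℝ (pd i (pd j (MAG.profile H))) p := fun i j =>
    differentiableAt_of_smoothOn W.isOpen (contDiffOn_pd W.isOpen (hs j) i) hp
  have hl : ∀ μ : Fin 4, μ ≠ 0 →
      pd μ (pd 2 (pd 2 (MAG.profile H))) p + pd μ (pd 3 (pd 3 (MAG.profile H))) p = 0 := by
    intro μ hμ
    have ha : DifferentiableAt ℝ (fun q => MAG.amplitude A φ₀ q ^ 2) p :=
      (differentiableAt_of_smoothOn W.isOpen W.amplitude hp).fun_pow 2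
    have ha0 : pd μ (fun q => MAG.amplitude A φ₀ q ^ 2) p = 0 :=
      pd_eq_zero_of_update fun q s => by simp [MAG.amplitude, hμ.symm]
    have h1 := hR μ
    change pd μ (fun q => -(1 / 2) * (pd 2 (pd 2 (MAG.profile H)) q +
      pd 3 (pd 3 (MAG.profile H)) q) + 2 * MAG.amplitude A φ₀ q ^ 2) p = 0 at h1
    rw [pd_add (((hs2 2 2).fun_add (hs2 3 3)).const_mul _) (ha.const_mul _),
      pd_const_mul _ ((hs2 2 2).fun_add (hs2 3 3)), pd_const_mul _ ha,
      pd_add (hs2 2 2) (hs2 3 3), ha0] at h1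
    linarith
  have c1 : pd 3 (pd 2 (pd 3 (MAG.profile H))) p = pd 2 (pd 3 (pd 3 (MAG.profile H))) p :=
    pd_comm W.isOpen (hs 3) hp 3 2
  have c2 : pd 2 (pd 2 (pd 3 (MAG.profile H))) p = pd 3 (pd 2 (pd 2 (MAG.profile H))) p := by
    rw [pd_congr_on W.isOpen hp fun q hq => W.hessian_comm hq 2 3]
    exact pd_comm W.isOpen (hs 2) hp 2 3
  rw [(W.pdM_coordCurv hp (μ := 2) (by decide)).1, (W.pdM_coordCurv hp (μ := 3) (by decide)).2,
    nullMat_add, c1, c2, ← mul_add, ← mul_add, hl 2 (by decide), hl 3 (by decide), mul_zero,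
    nullMat_zero]

/-- The first variation of the Lagrangian at the wave. -/
theorem fderiv_vary_ymLagrangian {δ : Fields} (hδ : δ.SmoothOn U) (ρ : ℝ) (hp : p ∈ U) :
    fderiv ℝ (fun x : ℝ × Pt => Fields.ymLagrangian ρ (F.vary δ x.1) x.2) (0, p) (1, 0) =
      (1 / ρ) * ((curvVar F.conMat δ.conMat 1 2 p * matCurv F.conMat 0 2 p).trace +
        (curvVar F.conMat δ.conMat 1 3 p * matCurv F.conMat 0 3 p).trace) := by
  have hdet : (F.g p).det = -1 := by rw [W.metric p hp, det_ppMetric]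
  rw [Fields.fderiv_vary_ymLagrangian W.isOpen W.smooth hδ ρ hp (by rw [hdet]; norm_num)
    (W.trace_frameCurv_mul hp)]
  -- Since `g^{0τ} ≠ 0` only for `τ = 1`, raising the indices of `R_{0i}` with `i = 2, 3` pairs it
  -- with the variation of `R_{1i}`. The two index orders and the two factors give four equal terms,
  -- turning `1/(4ρ)` into `1/ρ`.
  obtain ⟨S, hS⟩ : ∃ S : Fin 4 → Fin 4 → Fin 4 → ℝ, ∀ μ ν i, S μ ν i =
    (curvVar F.conMat δ.conMat μ ν p * matCurv F.conMat 0 i p).trace := ⟨_, fun _ _ _ => rfl⟩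
  have hS0 : ∀ μ ν, S μ ν 0 = 0 := fun μ ν => by simp [hS, matCurv]
  have hS1 : ∀ μ ν, S μ ν 1 = 0 := fun μ ν => by simp [hS, W.frameCurv_zero_one hp]
  have hSa : ∀ i, S i 1 i = -S 1 i i := fun i => by
    simp only [hS]
    rw [curvVar_antisymm, Matrix.neg_mul, Matrix.trace_neg]
  have hT : ∀ μ ν τ κ, (curvVar F.conMat δ.conMat μ ν p * matCurv F.conMat τ κ p).trace
      = (if τ = 0 then S μ ν κ else 0) - (if κ = 0 then S μ ν τ else 0) := by
    intro μ ν τ κ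
    rw [W.frameCurv_eq hp τ κ, Matrix.mul_sub, Matrix.trace_sub]
    split_ifs <;> simp [hS]
  have hT' : ∀ μ ν τ κ, (matCurv F.conMat μ ν p * curvVar F.conMat δ.conMat τ κ p).trace
      = (if μ = 0 then S τ κ ν else 0) - (if ν = 0 then S τ κ μ else 0) := by
    intro μ ν τ κ
    rw [Matrix.trace_mul_comm, hT]
  rw [← hS, ← hS]
  simp only [hT, hT', hdet, W.gInv_eq hp]
  simp [Fin.sum_univ_four, ppMetricInv, hS0, hS1, hSa]
  ring

/-- The first variation of the Lagrangian at a wave with parallel Ricci tensor is a divergence. -/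
theorem fderiv_vary_ymLagrangian_eq_div {δ : Fields} (hδ : δ.SmoothOn U) (ρ : ℝ)
    (hR : ∀ p ∈ U, ∀ μ, pd μ (waveRicci H A φ₀) p = 0) (hp : p ∈ U) :
    fderiv ℝ (fun x : ℝ × Pt => Fields.ymLagrangian ρ (F.vary δ x.1) x.2) (0, p) (1, 0) =
      (1 / ρ) * ((pd 1 (fun q => (δ.conMat 2 q * matCurv F.conMat 0 2 q).trace) p +
          pd 1 (fun q => (δ.conMat 3 q * matCurv F.conMat 0 3 q).trace) p) -
        (pd 2 (fun q => (δ.conMat 1 q * matCurv F.conMat 0 2 q).trace) p +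
          pd 3 (fun q => (δ.conMat 1 q * matCurv F.conMat 0 3 q).trace) p)) := by
  rw [W.fderiv_vary_ymLagrangian hδ ρ hp]
  congr 1
  have hN : ∀ i, SmoothMat (matCurv F.conMat 0 i) U := fun i =>
    SmoothMat.matCurv W.isOpen W.smooth.conMat 0 i
  have hpd : ∀ μ α i, pd μ (fun q => (δ.conMat α q * matCurv F.conMat 0 i q).trace) p =
      (pdM μ (δ.conMat α) p * matCurv F.conMat 0 i p).trace +
        (δ.conMat α p * pdM μ (matCurv F.conMat 0 i) p).trace := by
    intro μ α i
    rw [pd_trace W.isOpen ((hδ.conMat α).mul (hN i)) hp, pdM_mul W.isOpen (hδ.conMat α) (hN i) hp,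
      Matrix.trace_add]
  have hdiv : (δ.conMat 1 p * (F.frame p * pdM 2 (matCurv F.coordCon 0 2) p * F.cof p)).trace +
      (δ.conMat 1 p * (F.frame p * pdM 3 (matCurv F.coordCon 0 3) p * F.cof p)).trace = 0 := by
    rw [← Matrix.trace_add, ← mul_add, ← add_mul, ← mul_add, W.div_coordCurv (hR p hp) hp]
    simp
  obtain ⟨d2, d3⟩ := W.pdM_one_coordCurv hp
  simp only [hpd, W.pdM_frameCurv hp (show (1 : Fin 4) ≠ 0 by decide),
    W.pdM_frameCurv hp (show (2 : Fin 4) ≠ 0 by decide),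
    W.pdM_frameCurv hp (show (3 : Fin 4) ≠ 0 by decide), d2, d3]
  -- Cyclicity moves every `δ.conMat` to the front, where the commutators in `curvVar` match those
  -- in the derivatives of `R`.
  have cyc : ∀ a b c : Matrix (Fin 4) (Fin 4) ℝ, (a * b * c).trace = (b * (c * a)).trace := by
    intro a b c
    rw [Matrix.mul_assoc, Matrix.trace_mul_comm, Matrix.mul_assoc]
  simp only [curvVar, add_mul, sub_mul, mul_add, mul_sub, Matrix.trace_add, Matrix.trace_sub,
    cyc (F.conMat _ p), Matrix.mul_assoc (δ.conMat _ p), mul_zero, zero_mul, Matrix.trace_zero]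
  linarith

/-- A wave with parallel Ricci tensor solves the vacuum equations of the Yang–Mills Lagrangian. -/
theorem equationsOfMotion (ρ : ℝ) (hR : ∀ p ∈ U, ∀ μ, pd μ (waveRicci H A φ₀) p = 0) :
    F.YMEquationsOfMotion ρ U := by
  intro K δ hK hKU hδ
  have hδU : δ.SmoothOn U := ⟨fun a b => (hδ.smooth.1 a b).mono (Set.subset_univ _),
    fun a b => (hδ.smooth.2.1 a b).mono (Set.subset_univ _),
    fun μ a b => (hδ.smooth.2.2 μ a b).mono (Set.subset_univ _)⟩
  have hv0 : F.vary δ 0 = F := by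
    obtain ⟨m, c, k⟩ := F
    simp [Fields.vary]
  have h := hasDerivAt_setIntegral_of_contDiffOn
    (Fields.isOpen_varyDomain W.isOpen W.smooth hδU)
    (Fields.smooth_vary_ymLagrangian W.isOpen W.smooth hδU ρ) hK fun p hp => by
      refine ⟨hKU hp, ?_⟩
      change ((F.vary δ 0).g p).det ≠ 0
      rw [hv0, W.metric p (hKU hp), det_ppMetric]
      norm_num
  have hV : ∀ α i, ContDiffOn ℝ ∞ (fun q => (δ.conMat α q * matCurv F.conMat 0 i q).trace) U :=
    fun α i => (hδU.conMat α).trace_mul (SmoothMat.matCurv W.isOpen W.smooth.conMat 0 i)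
  have hV0 : ∀ α i q, q ∉ K → (δ.conMat α q * matCurv F.conMat 0 i q).trace = 0 := by
    intro α i q hq
    have : δ.conMat α q = 0 := by
      ext a b
      simp [Fields.conMat, (hδ.supp q hq).2.2]
    rw [this, zero_mul, Matrix.trace_zero]
  have hint : ∀ μ α i, IntegrableOn
      (pd μ (fun q => (δ.conMat α q * matCurv F.conMat 0 i q).trace)) K :=
    fun μ α i => integrableOn_pd W.isOpen hK hKU (hV α i) μ
  have hzero : ∀ μ α i,
      ∫ p in K, pd μ (fun q => (δ.conMat α q * matCurv F.conMat 0 i q).trace) p = 0 :=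
    fun μ α i => setIntegral_pd_eq_zero W.isOpen hK hKU (hV α i) (hV0 α i) μ
  rw [setIntegral_congr_fun hK.measurableSet fun p hp =>
    W.fderiv_vary_ymLagrangian_eq_div hδU ρ hR (hKU hp), integral_const_mul,
    integral_sub ((hint 1 2 2).fun_add (hint 1 3 3)) ((hint 2 1 2).fun_add (hint 3 1 3)),
    integral_add (hint 1 2 2) (hint 1 3 3), integral_add (hint 2 1 2) (hint 3 1 3),
    hzero, hzero, hzero, hzero] at h
  simp only [add_zero, sub_self, mul_zero] at h
  exact h

end IsAxialWave

end

end MAG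

theorem theorem7 (U : Set MAG.Pt) (hU : IsOpen U) (hUc : IsPreconnected U)
    (H : ℝ × ℝ × ℝ → ℝ) (hH : ContDiffOn ℝ ∞ (fun p : MAG.Pt => H (p 0, p 2, p 3)) U)
    (A : ℝ → ℝ) (φ₀ : ℝ) (hA : ContDiffOn ℝ ∞ (fun p : MAG.Pt => A (p 0 + φ₀)) U)
    (ρ : ℝ) (hρ : ρ ≠ 0)
    (F : MAG.Fields) (hF : F.SmoothOn U)
    (hpp : ∀ p ∈ U, F.g p = MAG.ppMetric H p)
    (hQ : ∀ p ∈ U, ∀ μ a b, F.nonmetricity p μ a b = 0)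
    (hT : ∀ p ∈ U, ∀ μ ν a, F.torsion p μ ν a =
      (1 / 3) * F.interior3 p a (F.star1 p (MAG.axialForm A φ₀ p)) μ ν) :
    (∀ p ∈ U, ∀ μ a b,
      MAG.covDeriv F.con F.ricci p μ a b = MAG.covDeriv F.leviCivita F.ricci p μ a b) ∧
    ((∀ p ∈ U, ∀ μ a b, MAG.covDeriv F.con F.ricci p μ a b = 0) ↔
      ∃ C : ℝ, ∀ p ∈ U, MAG.transLaplacian H p = (1 / 9) * A (p 0 + φ₀) ^ 2 + C) ∧
    ((∀ p ∈ U, ∀ μ a b, MAG.covDeriv F.con F.ricci p μ a b = 0) →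
      F.YMEquationsOfMotion ρ U) := by
  have W : MAG.IsAxialWave F U H A φ₀ :=
    ⟨hU, hH, contDiffOn_const.mul hA, hF, hpp, hQ, hT⟩
  refine ⟨fun p hp μ a b => ?_, W.ricci_parallel_iff hUc, fun h =>
    W.equationsOfMotion ρ fun p hp => W.pd_waveRicci_eq_zero h hp⟩
  rw [W.covDeriv_ricci hp (W.pd_frame hp), W.covDeriv_ricci hp (W.pd_frame_leviCivita hp)]
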